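/- Let $A,D\in\mathbb C^{n\times n}$, $\lambda_0\in\mathbb C$, and let $[\Xi\ \Xi_c]\in\mathbb C^{n\times n}$ be invertible, $[\Sigma\ \Sigma_c]=[\Xi\ \Xi_c]^{-*}$, with $$A[\Xi\ \Xi_c]=[\Xi\ \Xi_c]\begin{bmatrix}\lambda_0I+N&0\\0&A_{22}\end{bmatrix},\qquad N=\operatorname{diag}(N_1,\dots,N_k),\qquad \lambda_0\notin\Lambda(A_{22}),$$ where $N_j$ consists of $j\times j$ blocks of size $s_j\times s_j$, with $I_{s_j}$ on the first block superdiagonal and $0$ elsewhere ($s_1,\dots,s_{k-1}\ge0$, $s_k>0$). Put $D_{11}=\Sigma^*D\Xi$, $D_{12}=\Sigma^*D\Xi_c$, $D_{21}=\Sigma_c^*D\Xi$, $D_{22}=\Sigma_c^*D\Xi_c$. Partition $\Xi=[\Xi_1\ \cdots\ \Xi_k]$, $\Xi_j=[\Xi_{j1}\ \cdots\ \Xi_{jj}]$ conformally with $N$, and $\Sigma$ likewise. For $1\le i\le k+1$ let $\tilde\Xi_i=[\Xi_{i1}\ \Xi_{i+1,1}\cdots\Xi_{k1}]$, $\tilde\Sigma_i=[\Sigma_{ii}\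 \Sigma_{i+1,i+1}\cdots\Sigma_{kk}]$ and $W_i=\tilde\Sigma_i^*D\tilde\Xi_i$ (so $W_{k+1}$ is void and counts as invertible). Fix $\rho\in\{1,\dots,k\}$ and suppose that $W_1,\dots,W_{\rho+1}$ are invertible. For $1\le j\le\rho$ let $G_j^{(\rho)}=-W_{\rho+1}^{-1}\tilde\Sigma_{\rho+1}^*D\Xi_{j1}$. Let $S_\rho=\Sigma_{\rho\rho}^*D\Xi_{\rho1}+\Sigma_{\rho\rho}^*D\tilde\Xi_{\rho+1}G_\rho^{(\rho)}$, and let $\Theta_\rho$ be the matrix of $\rho\times\rho$ blocks of size $s_\rho\times s_\rho$ with $I_{s_\rho}$ on the first block superdiagonal, $S_\rho$ in the lower left corner and $0$ elsewhere ($\Theta_1=S_1$). Write $z=t^{1/\rho}$ for real $t>0$. Let $L=\operatorname{diag}(L_1,\dots,L_k)$ and $R=\operatorname{diag}(R_1,\dots,R_k)$, where $L_i=\operatorname{diag}(z^{-1}I_{s_i},\dots,z^{-i}I_{s_i})$ and $R_i=\operatorname{diag}(I_{s_i},zI_{s_i},\dots,z^{i-1}I_{s_i})$ if $i\le\rho$,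 whereas for $i>\rho$ the first $i-\rho$ diagonal blocks of $L_i$ and of $R_i$ are $I_{s_i}$, and the last $\rho$ ones are $z^{-1}I_{s_i},\dots,z^{-\rho}I_{s_i}$ and $I_{s_i},zI_{s_i},\dots,z^{\rho-1}I_{s_i}$, respectively. Let $G$ be the identity matrix plus the blocks of $G_j^{(\rho)}$, $1\le j\le\rho$, placed in the columns of $\Xi_{j1}$ and in the rows corresponding to $\Xi_{\rho+1,1},\dots,\Xi_{k1}$. Then there are matrices $X(t)\in\mathbb C^{n\times\rho s_\rho}$, $\hat\Theta_\rho(t)$, $\tilde X_1(t),\dots,\tilde X_k(t)$, $P(t)$ and $Y(t)$, depending on $t$, such that for all sufficiently small $t>0$ $$(A+tD)X=X(\lambda_0I+t^{1/\rho}\hat\Theta_\rho),$$ $X$ has full column rank, and the range of $X$ is the invariant subspace of $A+tD$ corresponding to all the eigenvalues of exact order $t^{1/\rho}$; that is, there are $c_0,C_0>0$ such that for all $0<c\le c_0$ and $C\ge C_0$ and all sufficiently small $t>0$ (depending on $c,C$), the range of $X(t)$ is the sum of the generalized eigenspaces of $A+tD$ for the eigenvalues $\lambda$ with $c\,t^{1/\rho}\le|\lambda-\lambda_0|\le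 C\,t^{1/\rho}$. Moreover, as $t\to0^+$, $\hat\Theta_\rho=\Theta_\rho+O(t^{1/\rho})$ and $$X=\tilde\Xi_\rho\begin{bmatrix}I_{s_\rho}&0_{s_\rho\times(\rho-1)s_\rho}\\G_\rho^{(\rho)}&0\end{bmatrix}+\sum_{i=1}^k\Xi_i\tilde X_i+O(t),$$ where $\tilde X_\rho=\operatorname{diag}(0_{s_\rho},t^{1/\rho}I_{s_\rho},\dots,t^{1-1/\rho}I_{s_\rho})$ and, for $i\ne\rho$, the $\ell$-th block row ($1\le\ell\le i$, with $s_i$ rows) of $\tilde X_i$ is $O(t^{1-(i-\ell+1)/\rho})$ if $i<\rho$ and $O(t^{\min\{\max\{\ell-1,1\},\rho\}/\rho})$ if $i>\rho$ (so the orders of the block rows are $t^{1/\rho},t^{1/\rho},t^{2/\rho},\dots,t^{1-1/\rho},t,\dots,t$ for $i>\rho$). Here $P=O(t)$ satisfies $(A_{22}+tD_{22})P-P(\lambda_0I+N+tD_{11})-tPD_{12}P+tD_{21}=0$. The rows of $Y$ that correspond to $\Xi_\rho$ form the identity matrix, and all its other rows are $O(t^{1/\rho})$. With $\hat U=L(zI)RG$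 and $\hat V=L\bigl(N+z^\rho(D_{11}+D_{12}P)\bigr)RG$ one has $\hat UY\hat\Theta_\rho=\hat VY$; $\hat\Theta_\rho$ is the submatrix of $\hat VY$ formed by the rows that correspond to $\Xi_\rho$; and $X=(\Xi+\Xi_cP)RGY$. -/

import Mathlib

open Filter Topology Asymptotics
open scoped Matrix

namespace JordanPert

/-- The possible sizes `1, …, k` of the Jordan blocks of the eigenvalue under consideration. -/
abbrev Size (k : ℕ) : Type := {j : ℕ // j ∈ Finset.Icc 1 k}

/-- Row index of the `j`-th diagonal block: `(ℓ, a)` stands for the `a`-th row of its `(ℓ+1)`-st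
block row (`j` block rows of height `s j`; indices of `Fin` start at `0`). -/
abbrev Blk {k : ℕ} (s : ℕ → ℕ) (j : Size k) : Type := Fin j.1 × Fin (s j.1)

/-- Index set of the modified Jordan form `diag(N_1, …, N_k)`. -/
abbrev JIdx (k : ℕ) (s : ℕ → ℕ) : Type := Σ j : Size k, Blk s j

/-- Index set of `[Ξ_{i,1}, Ξ_{i+1,1}, …, Ξ_{k,1}]`; it is empty for `i = k + 1`. -/
abbrev Tail (k : ℕ) (s : ℕ → ℕ) (i : ℕ) : Type :=
  {p : Σ j : Size k, Fin (s j.1) // i ≤ p.1.1}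

/-- The position of the first block in `{1, …, j}`. -/
def fst {k : ℕ} (j : Size k) : Fin j.1 := ⟨0, (Finset.mem_Icc.1 j.2).1⟩

/-- The position of the last block in `{1, …, j}`. -/
def lst {k : ℕ} (j : Size k) : Fin j.1 := ⟨j.1 - 1, Nat.sub_lt (Finset.mem_Icc.1 j.2).1 one_pos⟩

/-- The nilpotent matrix `N = diag(N_1, …, N_k)`, where `N_j` has `j × j` blocks, with `I_{s_j}` on
the first block superdiagonal and zero elsewhere. -/
def N (k : ℕ) (s : ℕ → ℕ) : Matrix (JIdx k s) (JIdx k s) ℂ := fun p q =>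
  if p.1 = q.1 ∧ (p.2.1 : ℕ) + 1 = q.2.1 ∧ (p.2.2 : ℕ) = q.2.2 then 1 else 0

section blocks

variable {n k : ℕ} {s : ℕ → ℕ}

/-- The block column `Ξ_i` of `Ξ = [Ξ_1, …, Ξ_k]`. -/
def blockCol (Ξ : Matrix (Fin n) (JIdx k s) ℂ) (i : Size k) : Matrix (Fin n) (Blk s i) ℂ :=
  fun r x => Ξ r ⟨i, x⟩

/-- The first block column `Ξ_{i,1}` of `Ξ_i`. -/
def firstCol (Ξ : Matrix (Fin n) (JIdx k s) ℂ) (i : Size k) : Matrix (Fin n) (Fin (s i.1)) ℂ :=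
  fun r a => Ξ r ⟨i, fst i, a⟩

/-- The last block column `Σ_{i,i}` of `Σ_i`. -/
def lastCol (Sg : Matrix (Fin n) (JIdx k s) ℂ) (i : Size k) : Matrix (Fin n) (Fin (s i.1)) ℂ :=
  fun r a => Sg r ⟨i, lst i, a⟩

/-- `[Ξ_{i,1}, Ξ_{i+1,1}, …, Ξ_{k,1}]` -/
def tailFirst (Ξ : Matrix (Fin n) (JIdx k s) ℂ) (i : ℕ) : Matrix (Fin n) (Tail k s i) ℂ :=
  fun r p => Ξ r ⟨p.1.1, fst p.1.1, p.1.2⟩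

/-- `[Σ_{i,i}, Σ_{i+1,i+1}, …, Σ_{k,k}]` -/
def tailLast (Sg : Matrix (Fin n) (JIdx k s) ℂ) (i : ℕ) : Matrix (Fin n) (Tail k s i) ℂ :=
  fun r p => Sg r ⟨p.1.1, lst p.1.1, p.1.2⟩

/-- `W_i`, the product of `[Σ_{i,i}, …, Σ_{k,k}]^*`, `D` and `[Ξ_{i,1}, …, Ξ_{k,1}]`;
the empty matrix for `i = k + 1`. -/
def W (D : Matrix (Fin n) (Fin n) ℂ) (Ξ Sg : Matrix (Fin n) (JIdx k s) ℂ) (i : ℕ) :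
    Matrix (Tail k s i) (Tail k s i) ℂ :=
  (tailLast Sg i)ᴴ * D * tailFirst Ξ i

/-- `G_j^{(ρ)} = -W_{ρ+1}⁻¹ Z_{ρ+1,j}`, where `Z_{ρ+1,j}` is the product of
`[Σ_{ρ+1,ρ+1}, …, Σ_{k,k}]^*`, `D` and `Ξ_{j,1}`. -/
noncomputable def Gblk (D : Matrix (Fin n) (Fin n) ℂ) (Ξ Sg : Matrix (Fin n) (JIdx k s) ℂ)
    (ρ j : Size k) : Matrix (Tail k s (ρ.1 + 1)) (Fin (s j.1)) ℂ :=
  -((W D Ξ Sg (ρ.1 + 1))⁻¹ * ((tailLast Sg (ρ.1 + 1))ᴴ * D * firstCol Ξ j))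

/-- `S_ρ = B_{ρ1}^{(ρρ)} + [B_{ρ1}^{(ρ,ρ+1)}, …, B_{ρ1}^{(ρ,k)}] G_ρ^{(ρ)}`. -/
noncomputable def S (D : Matrix (Fin n) (Fin n) ℂ) (Ξ Sg : Matrix (Fin n) (JIdx k s) ℂ)
    (ρ : Size k) : Matrix (Fin (s ρ.1)) (Fin (s ρ.1)) ℂ :=
  (lastCol Sg ρ)ᴴ * D * firstCol Ξ ρ
    + (lastCol Sg ρ)ᴴ * D * tailFirst Ξ (ρ.1 + 1) * Gblk D Ξ Sg ρ ρ

/-- `Θ_ρ`: `ρ × ρ` blocks, with `I_{s_ρ}` on the first block superdiagonal, `S_ρ` in the lower left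
corner and zero elsewhere; `Θ_1 = S_1`. -/
noncomputable def Theta (D : Matrix (Fin n) (Fin n) ℂ) (Ξ Sg : Matrix (Fin n) (JIdx k s) ℂ)
    (ρ : Size k) : Matrix (Blk s ρ) (Blk s ρ) ℂ := fun x y =>
  (if (x.1 : ℕ) + 1 = y.1 ∧ x.2 = y.2 then 1 else 0)
    + (if x.1 = lst ρ ∧ y.1 = fst ρ then S D Ξ Sg ρ x.2 y.2 else 0)

/-- The matrix with block rows `[I_{s_ρ}, 0]` and `[G_ρ^{(ρ)}, 0]`; the rows of the first one are
those of `Tail k s ρ` outside `Tail k s (ρ+1)`. -/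
noncomputable def lead (D : Matrix (Fin n) (Fin n) ℂ) (Ξ Sg : Matrix (Fin n) (JIdx k s) ℂ)
    (ρ : Size k) : Matrix (Tail k s ρ.1) (Blk s ρ) ℂ := fun p y =>
  if y.1 = fst ρ then
    if h : ρ.1 + 1 ≤ p.1.1.1 then Gblk D Ξ Sg ρ ρ ⟨p.1, h⟩ y.2
    else if (p.1.2 : ℕ) = y.2 then 1 else 0
  else 0

/-- The scaling `L = diag(L_1, …, L_k)`. For `i ≤ ρ`, `L_i` has the diagonal blocks
`z⁻¹ I, …, z⁻ⁱ I`; for `i > ρ`, it has `i - ρ` blocks `I` and then `z⁻¹ I, …, z^{-ρ} I`.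
(Truncated subtraction covers both cases.) -/
noncomputable def L (s : ℕ → ℕ) (ρ : Size k) (z : ℂ) : Matrix (JIdx k s) (JIdx k s) ℂ :=
  Matrix.diagonal fun p => (z ^ (((p.2.1 : ℕ) + 1) - (p.1.1 - ρ.1)))⁻¹

/-- The scaling `R = diag(R_1, …, R_k)`. For `i ≤ ρ`, `R_i` has the diagonal blocks
`I, z I, …, z^{i-1} I`; for `i > ρ`, it has `i - ρ` blocks `I` and then `I, z I, …, z^{ρ-1} I`. -/
noncomputable def R (s : ℕ → ℕ) (ρ : Size k) (z : ℂ) : Matrix (JIdx k s) (JIdx k s) ℂ :=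
  Matrix.diagonal fun p => z ^ ((p.2.1 : ℕ) - (p.1.1 - ρ.1))

/-- The elimination matrix `G`: the identity plus, for `j ≤ ρ`, the blocks of `G_j^{(ρ)}` in the
first block column belonging to `j` and the first block rows belonging to `ρ+1, …, k`. -/
noncomputable def G (D : Matrix (Fin n) (Fin n) ℂ) (Ξ Sg : Matrix (Fin n) (JIdx k s) ℂ)
    (ρ : Size k) : Matrix (JIdx k s) (JIdx k s) ℂ := fun p q =>
  (if p = q then 1 else 0)
    + (if h : ρ.1 + 1 ≤ p.1.1 ∧ p.2.1 = fst p.1 ∧ q.1.1 ≤ ρ.1 ∧ q.2.1 = fst q.1 then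
        Gblk D Ξ Sg ρ q.1 ⟨⟨p.1, p.2.2⟩, h.1⟩ q.2.2 else 0)

/-- The leading matrix of the scaled pencil `μ Û(z) - V̂(z)` (up to the order of rows and columns
within the part belonging to sizes `> ρ`). -/
noncomputable def Uhat (D : Matrix (Fin n) (Fin n) ℂ) (Ξ Sg : Matrix (Fin n) (JIdx k s) ℂ)
    (ρ : Size k) (z : ℂ) : Matrix (JIdx k s) (JIdx k s) ℂ :=
  L s ρ z * (z • (1 : Matrix (JIdx k s) (JIdx k s) ℂ)) * R s ρ z * G D Ξ Sg ρ

/-- The other matrix of the scaled pencil `μ Û(z) - V̂(z)`, with `E` in the role of the perturbation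
of the nilpotent part, `V̂(z) = L (N + z^ρ E) R G`. -/
noncomputable def Vhat (D : Matrix (Fin n) (Fin n) ℂ) (Ξ Sg : Matrix (Fin n) (JIdx k s) ℂ)
    (E : Matrix (JIdx k s) (JIdx k s) ℂ) (ρ : Size k) (z : ℂ) :
    Matrix (JIdx k s) (JIdx k s) ℂ :=
  L s ρ z * (N k s + z ^ ρ.1 • E) * R s ρ z * G D Ξ Sg ρ

end blocks

/-- `t^{1/ρ}` for a real `t > 0`. -/
noncomputable def root {k : ℕ} (ρ : Size k) (t : ℝ) : ℝ := t ^ (1 / (ρ.1 : ℝ))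

/-- `F(t) = O(t^c)` entrywise as `t → 0`, `t > 0`. -/
def IsO {α β : Type*} (F : ℝ → Matrix α β ℂ) (c : ℝ) : Prop :=
  ∀ x y, (fun t => F t x y) =O[𝓝[>] (0 : ℝ)] fun t : ℝ => t ^ c

/-- The sum of the generalized eigenspaces of `M` for the eigenvalues `μ` in the annulus
`a ≤ |μ - lam| ≤ b`. -/
noncomputable def spectralSubspace {n : ℕ} (M : Matrix (Fin n) (Fin n) ℂ) (lam : ℂ) (a b : ℝ) :
    Submodule ℂ (Fin n → ℂ) :=
  ⨆ μ ∈ {μ : ℂ | a ≤ ‖μ - lam‖ ∧ ‖μ - lam‖ ≤ b},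
    Module.End.maxGenEigenspace (Matrix.toLin' M) μ

end JordanPert

/-! Put z = t^{1/ρ}. A Riccati solution P = O(t) makes the range of Ξ + Ξc P invariant under A + tD,
which acts there as λ₀ + N + z^ρ E with E = D₁₁ + D₁₂P (`exists_riccati`,
`perturbed_mul_decoupled`). The scalings L and R turn the eigenvalue problem of N + z^ρ E at zμ into
the pencil μ Û(z) - V̂(z). This pencil is polynomial in z (`Uhat_eq_Upoly`, `Vhat_eq_Vpoly`), so z =
0 may be inserted.

At z = 0 the columns of ρ span a deflating subspace with matrix Θ_ρ: G performs the block
elimination that leaves S_ρ, the Schur complement of W_{ρ+1} in W_ρ. Invertibility of W_ρ makes Θ_ρ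
invertible (`isUnit_Theta`). The rest of the leading pencil has only the eigenvalues 0 and ∞.

This last fact, `eq_zero_of_leading_pencil`, serves twice. With Θ_ρ as the right factor it makes the
linearized equation for the deflating subspace injective, and the implicit function theorem
continues the subspace to small z (`exists_deflating`). With a scalar μ ≠ 0 it makes the quotient
pencil invertible; by compactness this persists on an annulus c ≤ |μ| ≤ C, so no eigenvalue of order
z is missed. The block row orders come from the recursion contained in (N + z^ρ E) Z = z Z Θ̂, where
Z = R G Y. -/

namespace JordanPert

/-! ### Implicit function theorem with a rate, and calculus of matrix functions -/

section Calculus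

attribute [local instance] Matrix.normedAddCommGroup Matrix.normedSpace

/-- An asymptotic form of the implicit function theorem, for an equation that is quadratic in the
unknown at the base point `p₀` of the parameter. -/
theorem exists_implicit_isBigO {V E : Type*} [NormedAddCommGroup V] [NormedSpace ℂ V]
    [CompleteSpace V] [NormedAddCommGroup E] [NormedSpace ℂ E] [FiniteDimensional ℂ E]
    {F : V × E → E} (hF : ContDiff ℂ 1 F) {p₀ : V} (T q : E → E)
    (hT : ∀ (c : ℂ) v, F (p₀, c • v) = c • T v + c ^ 2 • q v) (hinj : ∀ v, T v = 0 → v = 0)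
    {l : Filter ℝ} {p : ℝ → V} {r : ℝ → ℝ} (hr : Tendsto r l (𝓝 0))
    (hpr : (fun t => p t - p₀) =O[l] r) :
    ∃ x : ℝ → E, x =O[l] r ∧ ∀ᶠ t in l, F (p t, x t) = 0 := by
  have : CompleteSpace E := FiniteDimensional.complete ℂ E
  have hp : Tendsto p l (𝓝 p₀) := tendsto_sub_nhds_zero_iff.1 (hpr.trans_tendsto hr)
  have hs : HasStrictFDerivAt F (fderiv ℂ F (p₀, 0)) (p₀, 0) :=
    hF.contDiffAt.hasStrictFDerivAt (by norm_num)
  have h0 : F (p₀, 0) = 0 := by simpa using hT 0 0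
  -- The partial derivative in the unknown is read off along the lines c ↦ c • v, where the
  -- quadratic term has derivative zero at c = 0.
  have hker : ∀ v, (fderiv ℂ F (p₀, 0) ∘L .inr ℂ V E) v = T v := by
    intro v
    have h1 : HasDerivAt (fun c : ℂ => ((p₀, c • v) : V × E)) (0, v) 0 := by
      have := (hasDerivAt_id (0 : ℂ)).smul_const v
      simp only [one_smul, id] at this
      exact (hasDerivAt_const _ _).prodMk this
    have h2 : HasDerivAt (fun c : ℂ => F (p₀, c • v)) (fderiv ℂ F (p₀, 0) (0, v)) 0 := by
      have h3 : HasFDerivAt F (fderiv ℂ F (p₀, 0)) (p₀, (0 : ℂ) • v) := by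
        simpa using hs.hasFDerivAt
      exact h3.comp_hasDerivAt (0 : ℂ) h1
    have h4 : HasDerivAt (fun c : ℂ => c • T v + c ^ 2 • q v) (T v) 0 := by
      have := ((hasDerivAt_id (0 : ℂ)).smul_const (T v)).add
        (((hasDerivAt_id (0 : ℂ)).pow 2).smul_const (q v))
      convert this using 1
      · ext c; simp
      · simp
    rw [← funext fun c => hT c v] at h4
    simpa using h2.unique h4
  have hinv : (fderiv ℂ F (p₀, 0) ∘L .inr ℂ V E).IsInvertible := by
    have hi : Function.Injective (fderiv ℂ F (p₀, 0) ∘L .inr ℂ V E).toLinearMap := by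
      rw [injective_iff_map_eq_zero]
      intro v hv
      exact hinj v ((hker v).symm.trans hv)
    refine ⟨(LinearEquiv.ofInjectiveEndo _ hi).toContinuousLinearEquiv, ?_⟩
    ext v
    rfl
  -- The implicit function is differentiable at `p₀` with value 0 there, so it inherits the rate of
  -- `p t - p₀`.
  have hd := hs.hasStrictFDerivAt_implicitFunctionOfProdDomain hinv
  have hz : hs.implicitFunctionOfProdDomain hinv p₀ = 0 :=
    (hs.eventually_apply_eq_iff_implicitFunctionOfProdDomain hinv).self_of_nhds.1 rfl
  refine ⟨fun t => hs.implicitFunctionOfProdDomain hinv (p t), ?_, ?_⟩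
  · have := (hd.hasFDerivAt.isBigO_sub.comp_tendsto hp).trans hpr
    simpa [Function.comp_def, hz] using this
  · filter_upwards [hp.eventually (hs.eventually_apply_implicitFunctionOfProdDomain hinv)] with t ht
    rw [ht, h0]

theorem contDiff_matrix_mul {V a b c : Type*} [NormedAddCommGroup V] [NormedSpace ℂ V]
    [Fintype a] [Fintype b] [Fintype c] {f : V → Matrix a b ℂ} {g : V → Matrix b c ℂ}
    (hf : ContDiff ℂ 1 f) (hg : ContDiff ℂ 1 g) : ContDiff ℂ 1 fun x => f x * g x := by
  refine contDiff_pi.2 fun i => contDiff_pi.2 fun j => ?_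
  simp only [Matrix.mul_apply]
  exact ContDiff.sum fun l _ =>
    (contDiff_pi.1 (contDiff_pi.1 hf i) l).mul (contDiff_pi.1 (contDiff_pi.1 hg l) j)

theorem contDiff_matrix_diagonal {V a : Type*} [NormedAddCommGroup V] [NormedSpace ℂ V]
    [Fintype a] [DecidableEq a] {f : V → a → ℂ} (hf : ∀ i, ContDiff ℂ 1 fun x => f x i) :
    ContDiff ℂ 1 fun x => Matrix.diagonal (f x) := by
  refine contDiff_pi.2 fun i => contDiff_pi.2 fun j => ?_
  by_cases h : i = j
  · subst h; simpa using hf i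
  · simpa [Matrix.diagonal_apply_ne _ h] using contDiff_const

theorem isBigO_matrix {a b : Type*} [Fintype a] [Fintype b] {l : Filter ℝ}
    {f : ℝ → Matrix a b ℂ} {r : ℝ → ℝ} :
    f =O[l] r ↔ ∀ i j, (fun t => f t i j) =O[l] r := by
  constructor
  · intro h i j
    exact isBigO_pi.1 (isBigO_pi.1 h i) j
  · intro h
    exact isBigO_pi.2 fun i => isBigO_pi.2 fun j => h i j

end Calculus

theorem isBigO_mul_apply {a b c : Type*} [Fintype b] {l : Filter ℝ}
    {f : ℝ → Matrix a b ℂ} {g : ℝ → Matrix b c ℂ} {r₁ r₂ : ℝ → ℝ} {i : a} {j : c}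
    (hf : ∀ x, (fun t => f t i x) =O[l] r₁) (hg : ∀ x, (fun t => g t x j) =O[l] r₂) :
    (fun t => (f t * g t) i j) =O[l] fun t => r₁ t * r₂ t := by
  simp only [Matrix.mul_apply]
  exact IsBigO.fun_sum fun x _ => (hf x).mul (hg x)

/-! ### Block structure of N, G and the scaled pencil; the Schur complement -/

section Structure

variable {n k : ℕ} {s : ℕ → ℕ}

theorem Size.one_le (i : Size k) : 1 ≤ i.1 := (Finset.mem_Icc.1 i.2).1

theorem fst_val (i : Size k) : (fst i : ℕ) = 0 := rfl

theorem lst_val (i : Size k) : (lst i : ℕ) = i.1 - 1 := rfl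

theorem eq_fst_iff {i : Size k} {l : Fin i.1} : l = fst i ↔ (l : ℕ) = 0 := by
  rw [Fin.ext_iff, fst_val]

theorem eq_lst_iff {i : Size k} {l : Fin i.1} : l = lst i ↔ (l : ℕ) + 1 = i.1 := by
  have := i.one_le
  rw [Fin.ext_iff, lst_val]
  omega

/-- The rows that belong to `ρ`. -/
def rowsOf {β : Type*} (ρ : Size k) (M : Matrix (JIdx k s) β ℂ) : Matrix (Blk s ρ) β ℂ :=
  fun x y => M ⟨ρ, x⟩ y

/-- The matrix whose rows belonging to `ρ` form the identity, all other rows being zero. -/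
def Yzero (s : ℕ → ℕ) (ρ : Size k) : Matrix (JIdx k s) (Blk s ρ) ℂ :=
  fun p y => if p = ⟨ρ, y⟩ then 1 else 0

theorem Yzero_self (ρ : Size k) (x y : Blk s ρ) :
    Yzero s ρ ⟨ρ, x⟩ y = (1 : Matrix (Blk s ρ) (Blk s ρ) ℂ) x y := by
  simp [Yzero, Matrix.one_apply, Sigma.mk.injEq]

theorem Yzero_of_ne {ρ : Size k} {p : JIdx k s} (h : p.1 ≠ ρ) (y : Blk s ρ) :
    Yzero s ρ p y = 0 := by
  have : p ≠ ⟨ρ, y⟩ := fun h' => h (by rw [h'])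
  simp [Yzero, this]

theorem mul_Yzero {β : Type*} (ρ : Size k) (M : Matrix β (JIdx k s) ℂ) (b : β) (y : Blk s ρ) :
    (M * Yzero s ρ) b y = M b ⟨ρ, y⟩ := by
  simp [Matrix.mul_apply, Yzero]

theorem N_mul_apply_of_lt {β : Type*} (M : Matrix (JIdx k s) β ℂ) {i : Size k} {l : Fin i.1}
    (h : (l : ℕ) + 1 < i.1) (a : Fin (s i.1)) (y : β) :
    (N k s * M) ⟨i, l, a⟩ y = M ⟨i, ⟨l + 1, h⟩, a⟩ y := by
  rw [Matrix.mul_apply, Finset.sum_eq_single (⟨i, ⟨l + 1, h⟩, a⟩ : JIdx k s)]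
  · simp [N]
  · rintro ⟨j, l', a'⟩ - hne
    have : ¬ (i = j ∧ (l : ℕ) + 1 = l' ∧ (a : ℕ) = a') := by
      rintro ⟨rfl, h1, h2⟩
      apply hne
      congr
      · exact Fin.ext h1.symm
      · exact Fin.ext h2.symm
    simp [N, this]
  · simp

theorem N_mul_apply_of_not_lt {β : Type*} (M : Matrix (JIdx k s) β ℂ) {i : Size k} {l : Fin i.1}
    (h : ¬ (l : ℕ) + 1 < i.1) (a : Fin (s i.1)) (y : β) :
    (N k s * M) ⟨i, l, a⟩ y = 0 := by
  rw [Matrix.mul_apply]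
  refine Finset.sum_eq_zero ?_
  rintro ⟨j, l', a'⟩ -
  have : ¬ (i = j ∧ (l : ℕ) + 1 = l' ∧ (a : ℕ) = a') := by
    rintro ⟨rfl, h1, h2⟩
    exact h (h1 ▸ l'.2)
  simp [N, this]

variable (D : Matrix (Fin n) (Fin n) ℂ) (Ξ Sg : Matrix (Fin n) (JIdx k s) ℂ) (ρ : Size k)

theorem G_mul_apply_of_not {β : Type*} (M : Matrix (JIdx k s) β ℂ) {p : JIdx k s}
    (h : ¬ (ρ.1 < p.1.1 ∧ (p.2.1 : ℕ) = 0)) (y : β) : (G D Ξ Sg ρ * M) p y = M p y := by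
  rw [Matrix.mul_apply, Finset.sum_eq_single p]
  · have : ¬ (ρ.1 + 1 ≤ p.1.1 ∧ p.2.1 = fst p.1 ∧ p.1.1 ≤ ρ.1 ∧ p.2.1 = fst p.1) := by
      rintro ⟨h1, -, h2, -⟩; omega
    simp only [G]
    rw [dif_neg this]
    simp
  · intro q _ hne
    have : ¬ (ρ.1 + 1 ≤ p.1.1 ∧ p.2.1 = fst p.1 ∧ q.1.1 ≤ ρ.1 ∧ q.2.1 = fst q.1) := by
      rintro ⟨h1, h2, -⟩; exact h ⟨h1, eq_fst_iff.1 h2⟩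
    simp only [G]
    rw [dif_neg this, if_neg (Ne.symm hne)]
    simp
  · simp

/-- `G` acts as the identity on matrices without rows belonging to sizes at most `ρ`. -/
theorem G_mul_of_zero {β : Type*} (M : Matrix (JIdx k s) β ℂ)
    (h : ∀ p : JIdx k s, p.1.1 ≤ ρ.1 → ∀ y, M p y = 0) : G D Ξ Sg ρ * M = M := by
  ext p y
  rw [Matrix.mul_apply, Finset.sum_eq_single p]
  · have : ¬ (ρ.1 + 1 ≤ p.1.1 ∧ p.2.1 = fst p.1 ∧ p.1.1 ≤ ρ.1 ∧ p.2.1 = fst p.1) := by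
      rintro ⟨h1, -, h2, -⟩; omega
    simp only [G]
    rw [dif_neg this]
    simp
  · intro q _ hne
    by_cases hq : q.1.1 ≤ ρ.1
    · simp [h q hq y]
    · simp [G, hq, Ne.symm hne]
  · simp

/-- `Û(z)` in polynomial form. -/
noncomputable def Upoly (z : ℂ) : Matrix (JIdx k s) (JIdx k s) ℂ :=
  Matrix.diagonal (fun p : JIdx k s => if (p.2.1 : ℕ) + ρ.1 < p.1.1 then z else 1) * G D Ξ Sg ρ

/-- `V̂(z)` in polynomial form. -/
noncomputable def Vpoly (z : ℂ) (E : Matrix (JIdx k s) (JIdx k s) ℂ) :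
    Matrix (JIdx k s) (JIdx k s) ℂ :=
  (N k s + Matrix.diagonal (fun p : JIdx k s => z ^ (ρ.1 - (((p.2.1 : ℕ) + 1) - (p.1.1 - ρ.1)))) *
    E * R s ρ z) * G D Ξ Sg ρ

/-- In block row ℓ the exponents of z⁻¹ in L and of z in R differ by one, which cancels the factor
z, except where both truncated differences vanish; there z survives. -/
theorem Uhat_eq_Upoly {z : ℂ} (hz : z ≠ 0) : Uhat D Ξ Sg ρ z = Upoly D Ξ Sg ρ z := by
  unfold Uhat Upoly
  congr 1
  rw [L, R, mul_smul_comm, mul_one, smul_mul_assoc, Matrix.diagonal_mul_diagonal,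
    ← Matrix.diagonal_smul]
  congr 1
  ext p
  simp only [Pi.smul_apply, smul_eq_mul]
  split_ifs with h
  · rw [show (p.2.1 : ℕ) + 1 - (p.1.1 - ρ.1) = 0 by omega,
      show (p.2.1 : ℕ) - (p.1.1 - ρ.1) = 0 by omega]
    simp
  · rw [show (p.2.1 : ℕ) + 1 - (p.1.1 - ρ.1) = (p.2.1 : ℕ) - (p.1.1 - ρ.1) + 1 by omega, pow_succ]
    field_simp

/-- N links block ℓ to block ℓ + 1, and L at ℓ carries the inverse of the power of z that R carries
at ℓ + 1. -/
theorem L_mul_N_mul_R {z : ℂ} (hz : z ≠ 0) : L s ρ z * N k s * R s ρ z = N k s := by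
  ext p q
  rw [L, R, Matrix.mul_diagonal, Matrix.diagonal_mul]
  by_cases h : p.1 = q.1 ∧ (p.2.1 : ℕ) + 1 = q.2.1 ∧ (p.2.2 : ℕ) = q.2.2
  · rw [← h.2.1, ← h.1]
    simp [N, h, hz]
  · simp [N, h]

theorem Vhat_eq_Vpoly {z : ℂ} (hz : z ≠ 0) (E : Matrix (JIdx k s) (JIdx k s) ℂ) :
    Vhat D Ξ Sg E ρ z = Vpoly D Ξ Sg ρ z E := by
  unfold Vhat Vpoly
  rw [mul_add, add_mul, L_mul_N_mul_R ρ hz, mul_smul_comm, ← smul_mul_assoc]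
  congr 4
  rw [L, ← Matrix.diagonal_smul]
  congr 1
  ext p
  have h1 := p.2.1.2
  -- The negative powers in L never exceed ρ, so the factor z^ρ of the perturbation absorbs them.
  have h3 : (p.2.1 : ℕ) + 1 - (p.1.1 - ρ.1) ≤ ρ.1 := by omega
  simp only [Pi.smul_apply, smul_eq_mul]
  rw [pow_sub₀ _ hz h3]

theorem sum_tail_split {i : Size k} (f : Tail k s i.1 → ℂ) :
    ∑ p, f p = ∑ b, f ⟨⟨i, b⟩, le_rfl⟩ +
      ∑ p : Tail k s (i.1 + 1), f ⟨p.1, (Nat.le_succ _).trans p.2⟩ := by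
  let e : Fin (s i.1) ⊕ Tail k s (i.1 + 1) → Tail k s i.1 :=
    Sum.elim (fun b => ⟨⟨i, b⟩, le_rfl⟩) fun p => ⟨p.1, (Nat.le_succ _).trans p.2⟩
  have he : Function.Bijective e := by
    constructor
    · rintro (b | ⟨p, hp⟩) (b' | ⟨p', hp'⟩) h
      · simpa [e] using h
      · simp only [e, Sum.elim_inl, Sum.elim_inr, Subtype.mk.injEq] at h
        subst h
        simp at hp'
      · simp only [e, Sum.elim_inl, Sum.elim_inr, Subtype.mk.injEq] at h
        subst h
        simp at hp
      · simpa [e] using h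
    · rintro ⟨⟨j, b⟩, h⟩
      rcases Nat.lt_or_ge i.1 j.1 with hlt | hge
      · exact ⟨Sum.inr ⟨⟨j, b⟩, hlt⟩, rfl⟩
      · obtain rfl : j = i := Subtype.ext (le_antisymm hge h)
        exact ⟨Sum.inl b, rfl⟩
  rw [← he.sum_comp f, Fintype.sum_sum_type]
  rfl

/-- A sum over all indices reduces to the first block columns if the other terms vanish. -/
theorem sum_eq_sum_tail {i : ℕ} (f : JIdx k s → ℂ)
    (h : ∀ p : JIdx k s, ¬ (i ≤ p.1.1 ∧ (p.2.1 : ℕ) = 0) → f p = 0) :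
    ∑ p, f p = ∑ p : Tail k s i, f ⟨p.1.1, fst p.1.1, p.1.2⟩ := by
  symm
  refine Fintype.sum_of_injective (fun p : Tail k s i => (⟨p.1.1, fst p.1.1, p.1.2⟩ : JIdx k s))
    ?_ _ _ ?_ fun _ => rfl
  · rintro ⟨⟨j, b⟩, hj⟩ ⟨⟨j', b'⟩, hj'⟩ h
    simp only [Sigma.mk.injEq] at h
    obtain ⟨rfl, h⟩ := h
    simp at h
    simp [h]
  · rintro ⟨j, l, b⟩ hp
    refine h _ fun h' => hp ⟨⟨⟨j, b⟩, h'.1⟩, ?_⟩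
    obtain rfl : l = fst j := eq_fst_iff.2 h'.2
    rfl

/-- The matrix `lead`, with zero rows added. -/
noncomputable def leadAll : Matrix (JIdx k s) (Blk s ρ) ℂ := fun p y =>
  if h : ρ.1 ≤ p.1.1 ∧ (p.2.1 : ℕ) = 0 then lead D Ξ Sg ρ ⟨⟨p.1, p.2.2⟩, h.1⟩ y else 0

theorem mul_leadAll_apply {β : Type*} (M : Matrix β (JIdx k s) ℂ) (b : β) (y : Blk s ρ) :
    (M * leadAll D Ξ Sg ρ) b y =
      ∑ p : Tail k s ρ.1, M b ⟨p.1.1, fst p.1.1, p.1.2⟩ * lead D Ξ Sg ρ p y := by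
  rw [Matrix.mul_apply, sum_eq_sum_tail (i := ρ.1)]
  · refine Finset.sum_congr rfl ?_
    rintro ⟨⟨j, c⟩, hj⟩ -
    simp only [leadAll]
    rw [dif_pos ⟨hj, rfl⟩]
  · intro p hp
    rw [leadAll, dif_neg hp, mul_zero]

theorem tailFirst_mul_lead : tailFirst Ξ ρ.1 * lead D Ξ Sg ρ = Ξ * leadAll D Ξ Sg ρ := by
  ext r y
  rw [mul_leadAll_apply, Matrix.mul_apply]
  rfl

/-- `G` maps the block column `[0; I; 0]` to the leading part of the invariant subspace, up to the
rows that the scaling `R` makes small. -/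
theorem G_mul_Yzero_apply (p : JIdx k s) (y : Blk s ρ) :
    (G D Ξ Sg ρ * Yzero s ρ) p y =
      leadAll D Ξ Sg ρ p y + if (p.2.1 : ℕ) = 0 then 0 else Yzero s ρ p y := by
  by_cases h : ρ.1 < p.1.1 ∧ (p.2.1 : ℕ) = 0
  · obtain ⟨i, l, a⟩ := p
    obtain ⟨m, b⟩ := y
    obtain ⟨h1, h2⟩ := h
    obtain rfl : l = fst i := eq_fst_iff.2 h2
    simp only at h1
    have hne : i ≠ ρ := fun h => by subst h; exact lt_irrefl _ h1
    rw [mul_Yzero, leadAll, dif_pos ⟨h1.le, h2⟩]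
    simp only [G, lead, fst_val, Sigma.mk.injEq, hne, false_and, if_false, zero_add, if_true,
      add_zero, true_and, le_refl]
    by_cases hm : m = fst ρ
    · rw [dif_pos ⟨h1, hm⟩, if_pos hm, dif_pos (Nat.succ_le_of_lt h1)]
    · rw [dif_neg (fun h => hm h.2), if_neg hm]
  · rw [G_mul_apply_of_not _ _ _ _ _ h]
    obtain ⟨i, l, a⟩ := p
    obtain ⟨m, b⟩ := y
    simp only at h ⊢
    by_cases h0 : (l : ℕ) = 0
    · rw [if_pos h0, add_zero]
      have h1 : i.1 ≤ ρ.1 := by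
        by_contra h'; exact h ⟨not_le.1 h', h0⟩
      rcases h1.lt_or_eq with h1 | h1
      · have hne : i ≠ ρ := fun h => by subst h; exact lt_irrefl _ h1
        rw [Yzero_of_ne hne, leadAll, dif_neg]
        rintro ⟨h2, -⟩
        simp only at h2
        omega
      · obtain rfl : i = ρ := Subtype.ext h1
        obtain rfl := eq_fst_iff.2 h0
        rw [Yzero_self, leadAll, dif_pos ⟨le_rfl, h0⟩, lead, dif_neg (by simp)]
        simp only [Matrix.one_apply, Prod.mk.injEq, Fin.ext_iff (a := a)]
        by_cases hm : m = fst i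
        · simp [hm]
        · simp [hm, Ne.symm hm]
    · rw [if_neg h0, leadAll, dif_neg (fun h => h0 h.2), zero_add]

variable {D Ξ Sg ρ}

/-- `lead` is the block column [I; G_ρ] of the elimination of W_{ρ+1} from W_ρ, padded by zero
columns. The product with W_ρ has the Schur complement S_ρ in its first block row; by
`W_mul_lead_of_lt` the rows below vanish. -/
theorem W_mul_lead_self (a : Fin (s ρ.1)) (y : Blk s ρ) :
    (W D Ξ Sg ρ.1 * lead D Ξ Sg ρ) ⟨⟨ρ, a⟩, le_rfl⟩ y =
      if y.1 = fst ρ then S D Ξ Sg ρ a y.2 else 0 := by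
  rw [Matrix.mul_apply, sum_tail_split]
  by_cases hy : y.1 = fst ρ
  · rw [if_pos hy]
    simp only [lead, hy, if_true, S, Matrix.add_apply]
    congr 1
    · simp [Fin.ext_iff.symm]
      rfl
    · rw [Matrix.mul_apply]
      refine Finset.sum_congr rfl fun p _ => ?_
      rw [dif_pos p.2]
      rfl
  · simp [lead, hy]

theorem W_mul_lead_of_lt (hW : IsUnit (W D Ξ Sg (ρ.1 + 1))) {p : Tail k s ρ.1}
    (hp : ρ.1 + 1 ≤ p.1.1.1) (y : Blk s ρ) :
    (W D Ξ Sg ρ.1 * lead D Ξ Sg ρ) p y = 0 := by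
  rw [Matrix.mul_apply, sum_tail_split]
  by_cases hy : y.1 = fst ρ
  · have key : (W D Ξ Sg (ρ.1 + 1) * Gblk D Ξ Sg ρ ρ) ⟨p.1, hp⟩ y.2 =
        -((tailLast Sg (ρ.1 + 1))ᴴ * D * firstCol Ξ ρ) ⟨p.1, hp⟩ y.2 := by
      rw [Gblk, Matrix.mul_neg, Matrix.mul_nonsing_inv_cancel_left _ _
        ((Matrix.isUnit_iff_isUnit_det _).1 hW)]
      rfl
    have h1 : ∑ b, W D Ξ Sg ρ.1 p ⟨⟨ρ, b⟩, le_rfl⟩ * lead D Ξ Sg ρ ⟨⟨ρ, b⟩, le_rfl⟩ y =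
        ((tailLast Sg (ρ.1 + 1))ᴴ * D * firstCol Ξ ρ) ⟨p.1, hp⟩ y.2 := by
      simp [lead, hy, Fin.ext_iff.symm]
      rfl
    have h2 : ∑ q : Tail k s (ρ.1 + 1), W D Ξ Sg ρ.1 p ⟨q.1, (Nat.le_succ _).trans q.2⟩ *
        lead D Ξ Sg ρ ⟨q.1, (Nat.le_succ _).trans q.2⟩ y =
        (W D Ξ Sg (ρ.1 + 1) * Gblk D Ξ Sg ρ ρ) ⟨p.1, hp⟩ y.2 := by
      rw [Matrix.mul_apply]
      refine Finset.sum_congr rfl fun q _ => ?_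
      simp only [lead, hy, if_true]
      rw [dif_pos q.2]
      rfl
    rw [h1, h2, key, add_neg_cancel]
  · simp [lead, hy]

end Structure

/-! ### The pencil at z = 0: its deflating subspace and its remaining eigenvalues -/

section LeadingPencil

variable {n k : ℕ} {s : ℕ → ℕ}
variable (D : Matrix (Fin n) (Fin n) ℂ) (Ξ Sg : Matrix (Fin n) (JIdx k s) ℂ) (ρ : Size k)

theorem Upoly_mul_apply_of_not {β : Type*} (M : Matrix (JIdx k s) β ℂ) (z : ℂ) {p : JIdx k s}
    (h : ¬ (p.2.1 : ℕ) + ρ.1 < p.1.1) (y : β) : (Upoly D Ξ Sg ρ z * M) p y = M p y := by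
  rw [Upoly, Matrix.mul_assoc, Matrix.diagonal_mul, if_neg h, one_mul, G_mul_apply_of_not]
  omega

theorem Upoly_zero_mul_apply_of_lt {β : Type*} (M : Matrix (JIdx k s) β ℂ) {p : JIdx k s}
    (h : (p.2.1 : ℕ) + ρ.1 < p.1.1) (y : β) : (Upoly D Ξ Sg ρ 0 * M) p y = 0 := by
  rw [Upoly, Matrix.mul_assoc, Matrix.diagonal_mul, if_pos h, zero_mul]

theorem rowsOf_Upoly_mul {β : Type*} (M : Matrix (JIdx k s) β ℂ) (z : ℂ) :
    rowsOf ρ (Upoly D Ξ Sg ρ z * M) = rowsOf ρ M := by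
  ext x y
  exact Upoly_mul_apply_of_not D Ξ Sg ρ M z (by simp) y

theorem Upoly_zero_mul_Yzero : Upoly D Ξ Sg ρ 0 * Yzero s ρ = Yzero s ρ := by
  ext p y
  by_cases h : (p.2.1 : ℕ) + ρ.1 < p.1.1
  · rw [Upoly_zero_mul_apply_of_lt D Ξ Sg ρ _ h, Yzero_of_ne]
    rintro rfl
    omega
  · exact Upoly_mul_apply_of_not D Ξ Sg ρ _ 0 h y

/-- G changes only first block rows, and N, which shifts block rows up, discards exactly those. -/
theorem N_mul_G_mul {β : Type*} (M : Matrix (JIdx k s) β ℂ) :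
    N k s * (G D Ξ Sg ρ * M) = N k s * M := by
  ext ⟨i, l, a⟩ y
  by_cases h : (l : ℕ) + 1 < i.1
  · rw [N_mul_apply_of_lt _ h, N_mul_apply_of_lt _ h, G_mul_apply_of_not]
    simp
  · rw [N_mul_apply_of_not_lt _ h, N_mul_apply_of_not_lt _ h]

theorem Vpoly_mul {β : Type*} (z : ℂ) (E : Matrix (JIdx k s) (JIdx k s) ℂ)
    (M : Matrix (JIdx k s) β ℂ) :
    Vpoly D Ξ Sg ρ z E * M = N k s * M +
      Matrix.diagonal (fun p : JIdx k s => z ^ (ρ.1 - (((p.2.1 : ℕ) + 1) - (p.1.1 - ρ.1)))) *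
        (E * (R s ρ z * (G D Ξ Sg ρ * M))) := by
  rw [Vpoly, Matrix.mul_assoc, Matrix.add_mul, N_mul_G_mul]
  simp only [Matrix.mul_assoc]

/-- The perturbation enters the leading pencil only in the last block rows of sizes at least ρ, the
only rows where its prefactor is z ^ 0. -/
theorem Vpoly_zero_mul_apply_of_last {β : Type*} (E : Matrix (JIdx k s) (JIdx k s) ℂ)
    (M : Matrix (JIdx k s) β ℂ) {i : Size k} (hi : ρ.1 ≤ i.1) (a : Fin (s i.1)) (y : β) :
    (Vpoly D Ξ Sg ρ 0 E * M) ⟨i, lst i, a⟩ y =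
      (E * (R s ρ 0 * (G D Ξ Sg ρ * M))) ⟨i, lst i, a⟩ y := by
  have h1 := i.one_le
  rw [Vpoly_mul, Matrix.add_apply, N_mul_apply_of_not_lt _ (by rw [lst_val]; omega),
    Matrix.diagonal_mul, lst_val,
    show ρ.1 - (i.1 - 1 + 1 - (i.1 - ρ.1)) = 0 by omega, pow_zero, one_mul, zero_add]

theorem Vpoly_zero_mul_apply_of_not {β : Type*} (E : Matrix (JIdx k s) (JIdx k s) ℂ)
    (M : Matrix (JIdx k s) β ℂ) {p : JIdx k s} (hp : p.1.1 < ρ.1 ∨ (p.2.1 : ℕ) + 1 < p.1.1)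
    (y : β) :
    (Vpoly D Ξ Sg ρ 0 E * M) p y = (N k s * M) p y := by
  have h1 := p.2.1.2
  have h2 := ρ.one_le
  rw [Vpoly_mul, Matrix.add_apply, Matrix.diagonal_mul, zero_pow (by omega), zero_mul, add_zero]

theorem R_zero_mul_G_mul_Yzero : R s ρ 0 * (G D Ξ Sg ρ * Yzero s ρ) = leadAll D Ξ Sg ρ := by
  ext p y
  rw [R, Matrix.diagonal_mul, G_mul_Yzero_apply]
  by_cases h : (p.2.1 : ℕ) = 0
  · simp [h]
  · rw [if_neg h, leadAll, dif_neg fun h' => h h'.2, zero_add]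
    by_cases hp : p.1 = ρ
    · have hp' : p.1.1 = ρ.1 := by rw [hp]
      -- For the size ρ the exponent in R is the block index itself, which is nonzero here.
      rw [zero_pow (by omega), zero_mul]
    · rw [Yzero_of_ne hp, mul_zero]

variable {D Ξ Sg ρ}

/-- This is the purpose of G: it removes the coupling from the columns of ρ into all other rows, so
that `Yzero` spans a deflating subspace of the leading pencil. -/
theorem Vpoly_zero_mul_Yzero_of_ne (hW : IsUnit (W D Ξ Sg (ρ.1 + 1))) {p : JIdx k s}
    (hp : p.1 ≠ ρ) (y : Blk s ρ) : (Vpoly D Ξ Sg ρ 0 (Sgᴴ * D * Ξ) * Yzero s ρ) p y = 0 := by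
  obtain ⟨i, l, a⟩ := p
  have hne : i.1 ≠ ρ.1 := fun h => hp (Subtype.ext h)
  by_cases h : i.1 < ρ.1 ∨ (l : ℕ) + 1 < i.1
  · rw [Vpoly_zero_mul_apply_of_not _ _ _ _ _ _ h]
    by_cases hl : (l : ℕ) + 1 < i.1
    · rw [N_mul_apply_of_lt _ hl]
      exact Yzero_of_ne (p := ⟨i, ⟨l + 1, hl⟩, a⟩) hp y
    · rw [N_mul_apply_of_not_lt _ hl]
  · push Not at h
    obtain rfl : l = lst i := eq_lst_iff.2 (by have := l.2; omega)
    rw [Vpoly_zero_mul_apply_of_last _ _ _ _ _ _ h.1, R_zero_mul_G_mul_Yzero, mul_leadAll_apply]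
    exact (Matrix.mul_apply).symm.trans
      (W_mul_lead_of_lt hW (p := ⟨⟨i, a⟩, h.1⟩) (by simp only; omega) y)

theorem Vpoly_zero_mul_Yzero_self (x y : Blk s ρ) :
    (Vpoly D Ξ Sg ρ 0 (Sgᴴ * D * Ξ) * Yzero s ρ) ⟨ρ, x⟩ y = Theta D Ξ Sg ρ x y := by
  obtain ⟨l, a⟩ := x
  have h1 := y.1.2
  by_cases h : (l : ℕ) + 1 < ρ.1
  · rw [Vpoly_zero_mul_apply_of_not _ _ _ _ _ _ (Or.inr h), N_mul_apply_of_lt _ h, Yzero_self]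
    have h2 : l ≠ lst ρ := fun h' => by rw [eq_lst_iff] at h'; omega
    simp [Theta, h2, Matrix.one_apply, Prod.ext_iff, Fin.ext_iff]
  · obtain rfl : l = lst ρ := eq_lst_iff.2 (by have := l.2; omega)
    rw [Vpoly_zero_mul_apply_of_last _ _ _ _ _ _ le_rfl, R_zero_mul_G_mul_Yzero, mul_leadAll_apply]
    refine ((Matrix.mul_apply).symm.trans (W_mul_lead_self (ρ := ρ) a y)).trans ?_
    have h2 : ¬ ((lst ρ : ℕ) + 1 = y.1 ∧ a = y.2) := by
      rintro ⟨h2, -⟩; rw [lst_val] at *; omega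
    simp [Theta, h2]

theorem rowsOf_Vpoly_zero_mul_Yzero :
    rowsOf ρ (Vpoly D Ξ Sg ρ 0 (Sgᴴ * D * Ξ) * Yzero s ρ) = Theta D Ξ Sg ρ := by
  ext x y
  exact Vpoly_zero_mul_Yzero_self x y

/-- The superdiagonal identities confine a kernel vector to its first block. The last block row then
says that W_ρ kills the image of the vector under `lead`; W_ρ is injective, and `lead` contains an
identity block. -/
theorem isUnit_Theta (hW : IsUnit (W D Ξ Sg ρ.1)) (hW' : IsUnit (W D Ξ Sg (ρ.1 + 1))) :
    IsUnit (Theta D Ξ Sg ρ) := by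
  rw [← Matrix.mulVec_injective_iff_isUnit]
  rw [← Matrix.mulVec_injective_iff_isUnit] at hW
  rw [← Matrix.coe_mulVecLin, injective_iff_map_eq_zero]
  intro v hv
  have hv' : ∀ x, ∑ y, Theta D Ξ Sg ρ x y * v y = 0 := fun x => congrFun hv x
  have h0 : ∀ y : Blk s ρ, y.1 ≠ fst ρ → v y = 0 := by
    rintro ⟨l, a⟩ hl
    have hl0 : (l : ℕ) ≠ 0 := fun h => hl (eq_fst_iff.2 h)
    have h1 := l.2
    have h3 := hv' (⟨l - 1, by omega⟩, a)
    rw [Finset.sum_eq_single (l, a)] at h3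
    · have h4 : (⟨l - 1, by omega⟩ : Fin ρ.1) ≠ lst ρ := fun h' => by
        rw [eq_lst_iff] at h'; simp only at h'; omega
      have h5 : (l : ℕ) - 1 + 1 = l := by omega
      simpa [Theta, h4, h5] using h3
    · rintro ⟨l', a'⟩ - hne
      have h4 : (⟨l - 1, by omega⟩ : Fin ρ.1) ≠ lst ρ := fun h' => by
        rw [eq_lst_iff] at h'; simp only at h'; omega
      have h5 : ¬ ((l : ℕ) - 1 + 1 = l' ∧ a = a') := by
        rintro ⟨h6, rfl⟩
        exact hne (by rw [Prod.mk.injEq]; exact ⟨Fin.ext (by omega), rfl⟩)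
      simp [Theta, h4, h5]
    · simp
  have h1 : lead D Ξ Sg ρ *ᵥ v = 0 := by
    apply hW
    rw [Matrix.mulVec_zero, Matrix.mulVec_mulVec]
    ext p
    rcases Nat.lt_or_ge ρ.1 p.1.1.1 with hp | hp
    · simp only [Matrix.mulVec, dotProduct]
      exact Finset.sum_eq_zero fun y _ => by rw [W_mul_lead_of_lt hW' hp, zero_mul]
    · obtain ⟨⟨i, a⟩, hi⟩ := p
      obtain rfl : i = ρ := Subtype.ext (le_antisymm hp hi)
      refine Eq.trans ?_ (hv' (lst i, a))
      simp only [Matrix.mulVec, dotProduct]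
      refine Finset.sum_congr rfl fun y _ => ?_
      rw [W_mul_lead_self]
      have h1 := y.1.2
      have h2 : ¬ ((lst i : ℕ) + 1 = y.1 ∧ a = y.2) := by
        rintro ⟨h2, -⟩; rw [lst_val] at *; omega
      simp [Theta, h2]
  ext ⟨l, a⟩
  by_cases hl : l = fst ρ
  · subst hl
    have h2 := congrFun h1 ⟨⟨ρ, a⟩, le_rfl⟩
    simp only [Matrix.mulVec, dotProduct] at h2
    rw [Finset.sum_eq_single (fst ρ, a)] at h2
    · simpa [lead] using h2
    · rintro ⟨l', a'⟩ - hne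
      by_cases hl' : l' = fst ρ
      · subst hl'
        have : ¬ ((a : ℕ) = a') := fun h => hne (by rw [Fin.ext h])
        simp [lead, this]
      · simp [lead, hl']
    · simp
  · exact h0 _ hl

theorem row_eq_zero_of_mul {α β : Type*} [Fintype β] [DecidableEq β] {Q : Matrix β β ℂ}
    (hQ : IsUnit Q) {M : Matrix α β ℂ} {p : α} (h : ∀ y, (M * Q) p y = 0) (y : β) : M p y = 0 := by
  rw [← Matrix.mul_nonsing_inv_cancel_right Q M ((Matrix.isUnit_iff_isUnit_det _).1 hQ),
    Matrix.mul_apply]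
  exact Finset.sum_eq_zero fun x _ => by rw [h x, zero_mul]

/-- Away from the rows and columns that belong to `ρ`, the leading pencil has only the eigenvalues
zero and infinity. -/
theorem eq_zero_of_leading_pencil {β : Type*} [Fintype β] [DecidableEq β]
    (hW : IsUnit (W D Ξ Sg (ρ.1 + 1))) {Q : Matrix β β ℂ} (hQ : IsUnit Q)
    {M : Matrix (JIdx k s) β ℂ} (hρ : rowsOf ρ M = 0)
    (h : ∀ p : JIdx k s, p.1 ≠ ρ → ∀ y,
      (Upoly D Ξ Sg ρ 0 * M * Q) p y = (Vpoly D Ξ Sg ρ 0 (Sgᴴ * D * Ξ) * M) p y) : M = 0 := by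
  -- For sizes below ρ the equation reads M Q = N M. It is solved upwards from the last block row,
  -- `d` being the distance from it.
  have hlt : ∀ (i : Size k), i.1 < ρ.1 → ∀ (d : ℕ) (l : Fin i.1), (l : ℕ) + d + 1 = i.1 →
      ∀ a y, M ⟨i, l, a⟩ y = 0 := by
    intro i hi d
    have hne : i ≠ ρ := fun h => by rw [h] at hi; exact lt_irrefl _ hi
    induction d with
    | zero =>
      intro l hl a
      refine row_eq_zero_of_mul hQ fun y => ?_
      have := h ⟨i, l, a⟩ hne y
      rwa [Matrix.mul_assoc, Upoly_mul_apply_of_not _ _ _ _ _ _ (by simp only; omega),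
        Vpoly_zero_mul_apply_of_not _ _ _ _ _ _ (Or.inl hi),
        N_mul_apply_of_not_lt _ (by omega)] at this
    | succ d ih =>
      intro l hl a
      refine row_eq_zero_of_mul hQ fun y => ?_
      have := h ⟨i, l, a⟩ hne y
      rwa [Matrix.mul_assoc, Upoly_mul_apply_of_not _ _ _ _ _ _ (by simp only; omega),
        Vpoly_zero_mul_apply_of_not _ _ _ _ _ _ (Or.inl hi),
        N_mul_apply_of_lt _ (by omega), ih _ (by simp only; omega)] at this
  have hle : ∀ p : JIdx k s, p.1.1 ≤ ρ.1 → ∀ y, M p y = 0 := by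
    rintro ⟨i, l, a⟩ hi y
    rcases hi.lt_or_eq with hi | hi
    · exact hlt i hi (i.1 - 1 - l) l (by have := l.2; omega) a y
    · obtain rfl : i = ρ := Subtype.ext hi
      exact congrFun (congrFun hρ (l, a)) y
  -- For sizes above ρ, row ℓ gives block ℓ + 1 of M as row ℓ of Û(0) M Q. That row is zero for ℓ =
  -- 0, where Û(0) vanishes, and otherwise it vanishes with Û(0) or with block ℓ of M.
  have hgt : ∀ (i : Size k), ρ.1 < i.1 → ∀ (d : ℕ) (hd : d + 1 < i.1),
      ∀ a y, M ⟨i, ⟨d + 1, hd⟩, a⟩ y = 0 := by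
    intro i hi d
    have hne : i ≠ ρ := fun h => by rw [h] at hi; exact lt_irrefl _ hi
    induction d with
    | zero =>
      intro hd a y
      have := h ⟨i, ⟨0, by omega⟩, a⟩ hne y
      rw [Matrix.mul_assoc, Upoly_zero_mul_apply_of_lt _ _ _ _ _ (by simp only; omega),
        Vpoly_zero_mul_apply_of_not _ _ _ _ _ _ (Or.inr hd), N_mul_apply_of_lt _ hd] at this
      exact this.symm
    | succ d ih =>
      intro hd a y
      have := h ⟨i, ⟨d + 1, by omega⟩, a⟩ hne y
      rw [Vpoly_zero_mul_apply_of_not _ _ _ _ _ _ (Or.inr hd), N_mul_apply_of_lt _ hd] at this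
      rw [← this, Matrix.mul_assoc]
      by_cases hd' : d + 1 + ρ.1 < i.1
      · rw [Upoly_zero_mul_apply_of_lt _ _ _ _ _ hd']
      · rw [Upoly_mul_apply_of_not _ _ _ _ _ _ hd', Matrix.mul_apply]
        exact Finset.sum_eq_zero fun x _ => by rw [ih, zero_mul]
  have hpos : ∀ p : JIdx k s, ¬ (ρ.1 + 1 ≤ p.1.1 ∧ (p.2.1 : ℕ) = 0) → ∀ y, M p y = 0 := by
    rintro ⟨i, ⟨l, hl⟩, a⟩ hp y
    rcases Nat.lt_or_ge ρ.1 i.1 with hi | hi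
    · obtain _ | d := l
      · exact absurd ⟨hi, rfl⟩ hp
      · exact hgt i hi d hl a y
    · exact hle _ hi y
  -- Only the first block rows of sizes above ρ are left in M, and there R has the entry 0 ^ 0 = 1.
  have hR : R s ρ 0 * (G D Ξ Sg ρ * M) = M := by
    rw [G_mul_of_zero _ _ _ _ _ hle]
    ext p y
    rw [R, Matrix.diagonal_mul]
    by_cases hp : ρ.1 + 1 ≤ p.1.1 ∧ (p.2.1 : ℕ) = 0
    · rw [hp.2]; simp
    · rw [hpos p hp, mul_zero]
  let Mt : Matrix (Tail k s (ρ.1 + 1)) β ℂ := fun p y => M ⟨p.1.1, fst p.1.1, p.1.2⟩ y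
  -- The last block rows, not used so far for sizes above ρ, yield W_{ρ+1} Mt = 0. Their left side
  -- vanishes, since the last block is not the first one when the size is at least 2.
  have htail : W D Ξ Sg (ρ.1 + 1) * Mt = 0 := by
    ext ⟨⟨i, a⟩, hi⟩ y
    simp only at hi
    have hne : i ≠ ρ := fun h => by rw [h] at hi; omega
    have h1 := h ⟨i, lst i, a⟩ hne y
    have hl : (lst i : ℕ) = i.1 - 2 + 1 := by
      have := ρ.one_le
      rw [lst_val]; omega
    rw [Vpoly_zero_mul_apply_of_last _ _ _ _ _ _ (by omega), hR, Matrix.mul_assoc,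
      Upoly_mul_apply_of_not _ _ _ _ _ _ (by have := ρ.one_le; simp only; omega),
      Matrix.mul_apply, Finset.sum_eq_zero, Matrix.mul_apply, sum_eq_sum_tail (i := ρ.1 + 1)] at h1
    · exact h1.symm
    · intro p hp
      rw [hpos p hp, mul_zero]
    · intro x _
      rw [hpos _ (by simp only; omega), zero_mul]
  have htail' : Mt = 0 := by
    have := Matrix.nonsing_inv_mul_cancel_left (W D Ξ Sg (ρ.1 + 1)) Mt
      ((Matrix.isUnit_iff_isUnit_det _).1 hW)
    rw [← this, htail, Matrix.mul_zero]
  ext p y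
  by_cases hp : ρ.1 + 1 ≤ p.1.1 ∧ (p.2.1 : ℕ) = 0
  · obtain ⟨i, l, a⟩ := p
    obtain rfl : l = fst i := eq_fst_iff.2 hp.2
    exact congrFun (congrFun htail' ⟨⟨i, a⟩, hp.1⟩) y
  · exact hpos p hp y

end LeadingPencil

/-! ### Powers of t^{1/ρ} -/

section Root

variable {k : ℕ} (ρ : Size k)

theorem root_pos {t : ℝ} (ht : 0 < t) : 0 < root ρ t := Real.rpow_pos_of_pos ht _

theorem root_pow {t : ℝ} (ht : 0 < t) (j : ℕ) : root ρ t ^ j = t ^ ((j : ℝ) / (ρ.1 : ℝ)) := by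
  rw [root, ← Real.rpow_natCast, ← Real.rpow_mul ht.le]
  congr 1
  ring

theorem root_pow_self {t : ℝ} (ht : 0 < t) : root ρ t ^ ρ.1 = t := by
  have : (ρ.1 : ℝ) ≠ 0 := by have := ρ.one_le; positivity
  rw [root_pow ρ ht, div_self this, Real.rpow_one]

theorem tendsto_root : Tendsto (root ρ) (𝓝[>] 0) (𝓝 0) := by
  have h : (0 : ℝ) < 1 / (ρ.1 : ℝ) := by have := ρ.one_le; positivity
  have h2 := (Real.continuousAt_rpow_const 0 (1 / (ρ.1 : ℝ)) (Or.inr h.le)).tendsto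
  rw [Real.zero_rpow h.ne'] at h2
  exact h2.mono_left nhdsWithin_le_nhds

theorem isBigO_root_pow {i j : ℕ} (h : j ≤ i) :
    (fun t => root ρ t ^ i) =O[𝓝[>] 0] fun t => root ρ t ^ j := by
  have h1 : (fun t => root ρ t ^ (i - j)) =O[𝓝[>] 0] fun _ => (1 : ℝ) :=
    ((tendsto_root ρ).pow (i - j)).isBigO_one ℝ
  simpa [← pow_add, Nat.sub_add_cancel h] using h1.mul (isBigO_refl (fun t => root ρ t ^ j) _)

theorem isBigO_id_root : (fun t : ℝ => t ^ (1 : ℝ)) =O[𝓝[>] 0] root ρ := by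
  refine IsBigO.congr' (isBigO_root_pow ρ ρ.one_le) ?_ ?_
  · filter_upwards [self_mem_nhdsWithin] with t ht
    rw [root_pow_self ρ ht, Real.rpow_one]
  · exact Eventually.of_forall fun t => pow_one _

end Root

/-! ### Nilpotency of N and injectivity of the Sylvester operator -/

theorem N_pow_apply (k : ℕ) (s : ℕ → ℕ) (j : ℕ) {p : JIdx k s} (h : p.1.1 ≤ p.2.1 + j)
    (q : JIdx k s) : (N k s ^ j) p q = 0 := by
  induction j generalizing p with
  | zero => exact absurd p.2.1.2 (by omega)
  | succ j ih =>
    obtain ⟨i, l, a⟩ := p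
    rw [pow_succ']
    by_cases hl : (l : ℕ) + 1 < i.1
    · rw [N_mul_apply_of_lt _ hl]
      exact ih (by simp only at h ⊢; omega)
    · rw [N_mul_apply_of_not_lt _ hl]

theorem isNilpotent_N (k : ℕ) (s : ℕ → ℕ) : IsNilpotent (N k s) :=
  ⟨k, by
    ext p q
    exact N_pow_apply k s k (by have := (Finset.mem_Icc.1 p.1.2).2; omega) q⟩

/-- The equation iterates to (B - λ)^j Q = Q M^j. The right side vanishes for large j, while B - λ
is invertible. -/
theorem eq_zero_of_sylvester {ι κ : Type*} [Fintype ι] [DecidableEq ι] [Fintype κ] [DecidableEq κ]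
    {B : Matrix ι ι ℂ} {lam : ℂ} (hB : lam ∉ spectrum ℂ B) {M : Matrix κ κ ℂ} (hM : IsNilpotent M)
    {Q : Matrix ι κ ℂ} (h : B * Q - Q * (lam • 1 + M) = 0) : Q = 0 := by
  rw [spectrum.notMem_iff] at hB
  have hB' : IsUnit (B - algebraMap ℂ _ lam) := by
    rw [← neg_sub]; exact hB.neg
  have h1 : (B - algebraMap ℂ _ lam) * Q = Q * M := by
    rw [Algebra.algebraMap_eq_smul_one, Matrix.sub_mul, Matrix.smul_mul, Matrix.one_mul]
    rw [Matrix.mul_add, Matrix.mul_smul, Matrix.mul_one] at h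
    rw [← sub_eq_zero, ← h]
    abel
  have h2 : ∀ j : ℕ, (B - algebraMap ℂ _ lam) ^ j * Q = Q * M ^ j := by
    intro j
    induction j with
    | zero => simp
    | succ j ih => rw [pow_succ, Matrix.mul_assoc, h1, ← Matrix.mul_assoc, ih, pow_succ,
        Matrix.mul_assoc]
  obtain ⟨j, hj⟩ := hM
  have h3 := h2 j
  rw [hj, Matrix.mul_zero] at h3
  have h4 := Matrix.nonsing_inv_mul_cancel_left _ Q ((Matrix.isUnit_iff_isUnit_det _).1 (hB'.pow j))
  rw [← h4, h3, Matrix.mul_zero]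

/-! ### The Riccati equation and the deflating subspace for small t -/

section Implicit

attribute [local instance] Matrix.normedAddCommGroup Matrix.normedSpace

/-- The Riccati equation of the decoupling has a solution of the order of the perturbation. -/
theorem exists_riccati {ι κ : Type*} [Fintype ι] [DecidableEq ι] [Fintype κ] [DecidableEq κ]
    {B : Matrix ι ι ℂ} {lam : ℂ} (hB : lam ∉ spectrum ℂ B) {M : Matrix κ κ ℂ} (hM : IsNilpotent M)
    (D₁₁ : Matrix κ κ ℂ) (D₁₂ : Matrix κ ι ℂ) (D₂₁ : Matrix ι κ ℂ) (D₂₂ : Matrix ι ι ℂ) :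
    ∃ P : ℝ → Matrix ι κ ℂ, IsO P 1 ∧ ∀ᶠ t : ℝ in 𝓝[>] 0,
      (B + (t : ℂ) • D₂₂) * P t - P t * (lam • (1 : Matrix _ _ ℂ) + M + (t : ℂ) • D₁₁)
        - (t : ℂ) • (P t * D₁₂ * P t) + (t : ℂ) • D₂₁ = 0 := by
  let F : ℂ × Matrix ι κ ℂ → Matrix ι κ ℂ := fun x =>
    (B + x.1 • D₂₂) * x.2 - x.2 * (lam • (1 : Matrix _ _ ℂ) + M + x.1 • D₁₁)
        - x.1 • (x.2 * D₁₂ * x.2) + x.1 • D₂₁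
  have hF : ContDiff ℂ 1 F := by
    have h1 : ContDiff ℂ 1 fun x : ℂ × Matrix ι κ ℂ => x.1 := contDiff_fst
    have h2 : ContDiff ℂ 1 fun x : ℂ × Matrix ι κ ℂ => x.2 := contDiff_snd
    exact (((contDiff_matrix_mul (contDiff_const.add (h1.smul contDiff_const)) h2).sub
      (contDiff_matrix_mul h2 (contDiff_const.add (h1.smul contDiff_const)))).sub
      (h1.smul (contDiff_matrix_mul (contDiff_matrix_mul h2 contDiff_const) h2))).add
      (h1.smul contDiff_const)
  -- At t = 0 the Riccati equation is linear in the unknown: the Sylvester operator, with no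
  -- quadratic part.
  obtain ⟨P, hP1, hP2⟩ := exists_implicit_isBigO hF (p₀ := 0)
    (fun Q => B * Q - Q * (lam • 1 + M)) (fun _ => 0)
    (fun c Q => by simp [F, smul_sub]) (fun Q hQ => eq_zero_of_sylvester hB hM hQ)
    (l := 𝓝[>] 0) (p := fun t : ℝ => (t : ℂ)) (r := fun t : ℝ => t)
    nhdsWithin_le_nhds (by
      simp only [sub_zero]
      exact IsBigO.of_bound 1 (Eventually.of_forall fun t => by simp))
  refine ⟨P, fun x y => ?_, hP2⟩
  simpa using isBigO_matrix.1 hP1 x y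

variable {n k : ℕ} {s : ℕ → ℕ}
variable (D : Matrix (Fin n) (Fin n) ℂ) (Ξ Sg : Matrix (Fin n) (JIdx k s) ℂ) (ρ : Size k)

theorem contDiff_Upoly : ContDiff ℂ 1 (Upoly D Ξ Sg ρ) := by
  refine contDiff_matrix_mul (contDiff_matrix_diagonal fun p => ?_) contDiff_const
  split_ifs
  · exact contDiff_id
  · exact contDiff_const

theorem contDiff_Vpoly : ContDiff ℂ 1 fun x : ℂ × Matrix (JIdx k s) (JIdx k s) ℂ =>
    Vpoly D Ξ Sg ρ x.1 x.2 :=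
  contDiff_matrix_mul (contDiff_const.add (contDiff_matrix_mul (contDiff_matrix_mul
    (contDiff_matrix_diagonal fun _ => contDiff_fst.pow _) contDiff_snd)
    (contDiff_matrix_diagonal fun _ => contDiff_fst.pow _))) contDiff_const

theorem contDiff_rowsOf {V β : Type*} [NormedAddCommGroup V] [NormedSpace ℂ V] [Fintype β]
    {f : V → Matrix (JIdx k s) β ℂ} (hf : ContDiff ℂ 1 f) : ContDiff ℂ 1 fun x => rowsOf ρ (f x) :=
  contDiff_pi.2 fun x => contDiff_pi.2 fun y => contDiff_pi.1 (contDiff_pi.1 hf ⟨ρ, x⟩) y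

theorem Yzero_mul_apply_of_ne {β : Type*} (M : Matrix (Blk s ρ) β ℂ) {p : JIdx k s} (h : p.1 ≠ ρ)
    (y : β) : (Yzero s ρ * M) p y = 0 := by
  rw [Matrix.mul_apply]
  exact Finset.sum_eq_zero fun x _ => by rw [Yzero_of_ne h, zero_mul]

theorem rowsOf_add {β : Type*} (M M' : Matrix (JIdx k s) β ℂ) :
    rowsOf ρ (M + M') = rowsOf ρ M + rowsOf ρ M' := rfl

theorem rowsOf_smul {β : Type*} (c : ℂ) (M : Matrix (JIdx k s) β ℂ) :
    rowsOf ρ (c • M) = c • rowsOf ρ M := rfl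

theorem rowsOf_Yzero : rowsOf ρ (Yzero s ρ) = 1 := by
  ext x y
  exact Yzero_self ρ x y

variable {D Ξ Sg ρ}

/-- The scaled pencil has a deflating subspace close to the one that belongs to `ρ` in the leading
pencil. -/
theorem exists_deflating (hW : IsUnit (W D Ξ Sg ρ.1)) (hW' : IsUnit (W D Ξ Sg (ρ.1 + 1)))
    {E : ℝ → Matrix (JIdx k s) (JIdx k s) ℂ}
    (hE : IsO (fun t => E t - Sgᴴ * D * Ξ) (1 / (ρ.1 : ℝ))) :
    ∃ Y : ℝ → Matrix (JIdx k s) (Blk s ρ) ℂ,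
      (∀ᶠ t in 𝓝[>] 0, rowsOf ρ (Y t) = 1) ∧
      IsO (fun t => Y t - Yzero s ρ) (1 / (ρ.1 : ℝ)) ∧
      (∀ᶠ t in 𝓝[>] 0,
        Upoly D Ξ Sg ρ (root ρ t) * Y t * rowsOf ρ (Vpoly D Ξ Sg ρ (root ρ t) (E t) * Y t) =
          Vpoly D Ξ Sg ρ (root ρ t) (E t) * Y t) ∧
      IsO (fun t => rowsOf ρ (Vpoly D Ξ Sg ρ (root ρ t) (E t) * Y t) - Theta D Ξ Sg ρ)
        (1 / (ρ.1 : ℝ)) := by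
  let J := JIdx k s
  let H : (ℂ × Matrix J J ℂ) × Matrix J (Blk s ρ) ℂ → Matrix J (Blk s ρ) ℂ := fun x =>
    Upoly D Ξ Sg ρ x.1.1 * (Yzero s ρ + x.2) *
      rowsOf ρ (Vpoly D Ξ Sg ρ x.1.1 x.1.2 * (Yzero s ρ + x.2)) -
      Vpoly D Ξ Sg ρ x.1.1 x.1.2 * (Yzero s ρ + x.2)
  -- The rows of ρ carry the normalization of Y, the other rows the deflating equation. On the rows
  -- of ρ that equation is then automatic, because Û acts there as the identity and the right factor
  -- is taken to be the ρ-rows of V̂ Y.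
  let F : (ℂ × Matrix J J ℂ) × Matrix J (Blk s ρ) ℂ → Matrix J (Blk s ρ) ℂ := fun x p y =>
    if p.1 = ρ then x.2 p y else H x p y
  have hY : ContDiff ℂ 1 fun x : (ℂ × Matrix J J ℂ) × Matrix J (Blk s ρ) ℂ => Yzero s ρ + x.2 :=
    contDiff_const.add contDiff_snd
  have hV : ContDiff ℂ 1 fun x : (ℂ × Matrix J J ℂ) × Matrix J (Blk s ρ) ℂ =>
      Vpoly D Ξ Sg ρ x.1.1 x.1.2 * (Yzero s ρ + x.2) :=
    contDiff_matrix_mul ((contDiff_Vpoly D Ξ Sg ρ).comp contDiff_fst) hY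
  have hU : ContDiff ℂ 1 fun x : (ℂ × Matrix J J ℂ) × Matrix J (Blk s ρ) ℂ =>
      Upoly D Ξ Sg ρ x.1.1 :=
    (contDiff_Upoly D Ξ Sg ρ).comp (contDiff_fst.comp contDiff_fst)
  have hH : ContDiff ℂ 1 H :=
    (contDiff_matrix_mul (contDiff_matrix_mul hU hY) (contDiff_rowsOf ρ hV)).sub hV
  have hF : ContDiff ℂ 1 F := by
    refine contDiff_pi.2 fun p => contDiff_pi.2 fun y => ?_
    by_cases hp : p.1 = ρ
    · simp only [F, hp, if_true]
      exact contDiff_pi.1 (contDiff_pi.1 contDiff_snd p) y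
    · simp only [F, hp, if_false]
      exact contDiff_pi.1 (contDiff_pi.1 hH p) y
  have hΘ := isUnit_Theta hW hW'
  set U₀ := Upoly D Ξ Sg ρ 0 with hU₀
  set V₀ := Vpoly D Ξ Sg ρ 0 (Sgᴴ * D * Ξ) with hV₀
  have hpr : (fun t => (((root ρ t : ℂ), E t) : ℂ × Matrix J J ℂ) - (0, Sgᴴ * D * Ξ))
      =O[𝓝[>] 0] root ρ := by
    simp only [Prod.mk_sub_mk, sub_zero]
    refine IsBigO.prod_left ?_ (isBigO_matrix.2 hE)
    exact IsBigO.of_bound 1 (Eventually.of_forall fun t => by simp)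
  -- Varying the right factor contributes `Yzero` times the ρ-rows of V₀ M, which is zero off the
  -- rows of ρ and hence absent here.
  let T : Matrix J (Blk s ρ) ℂ → Matrix J (Blk s ρ) ℂ := fun M p y =>
    if p.1 = ρ then M p y else (U₀ * M * Theta D Ξ Sg ρ - V₀ * M) p y
  let q : Matrix J (Blk s ρ) ℂ → Matrix J (Blk s ρ) ℂ := fun M p y =>
    if p.1 = ρ then 0 else (U₀ * M * rowsOf ρ (V₀ * M)) p y
  obtain ⟨δ, hδ1, hδ2⟩ := exists_implicit_isBigO hF (p₀ := (0, Sgᴴ * D * Ξ))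
    T q (fun c M => by
      ext p y
      change F _ p y = c * T M p y + c ^ 2 * q M p y
      by_cases hp : p.1 = ρ
      · simp [F, T, q, hp]
      · have h1 : H ((0, Sgᴴ * D * Ξ), c • M) =
            Yzero s ρ * Theta D Ξ Sg ρ + c • (Yzero s ρ * rowsOf ρ (V₀ * M)) - V₀ * Yzero s ρ +
            c • (U₀ * M * Theta D Ξ Sg ρ - V₀ * M) + c ^ 2 • (U₀ * M * rowsOf ρ (V₀ * M)) := by
          simp only [H, ← hU₀, ← hV₀, Matrix.mul_add, Matrix.mul_smul, rowsOf_add, rowsOf_smul,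
            Matrix.add_mul, Matrix.smul_mul]
          rw [hU₀, Upoly_zero_mul_Yzero, hV₀, rowsOf_Vpoly_zero_mul_Yzero, ← hU₀, ← hV₀]
          simp only [smul_sub, smul_smul, pow_two]
          abel
        simp only [F, T, q, hp, if_false, h1, Matrix.add_apply, Matrix.sub_apply, Matrix.smul_apply]
        rw [Yzero_mul_apply_of_ne _ _ hp, Yzero_mul_apply_of_ne _ _ hp,
          Vpoly_zero_mul_Yzero_of_ne hW' hp]
        simp)
    (fun M hM => by
      refine eq_zero_of_leading_pencil hW' hΘ ?_ fun p hp y => ?_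
      · ext x y
        have := congrFun (congrFun hM ⟨ρ, x⟩) y
        simp only [T, if_true] at this
        exact this
      · have := congrFun (congrFun hM p) y
        simp only [T, hp, if_false] at this
        exact sub_eq_zero.1 this)
    (tendsto_root ρ) hpr
  have hrow : ∀ᶠ t in 𝓝[>] 0, rowsOf ρ (Yzero s ρ + δ t) = 1 := by
    filter_upwards [hδ2] with t ht
    rw [rowsOf_add, rowsOf_Yzero, add_eq_left]
    ext x y
    have := congrFun (congrFun ht ⟨ρ, x⟩) y
    simp only [F, if_true] at this
    exact this
  refine ⟨fun t => Yzero s ρ + δ t, hrow, ?_, ?_, ?_⟩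
  · simp only [add_sub_cancel_left]
    exact isBigO_matrix.1 hδ1
  · filter_upwards [hδ2, hrow] with t ht htr
    ext p y
    by_cases hp : p.1 = ρ
    · obtain ⟨i, x⟩ := p
      obtain rfl : i = ρ := hp
      rw [Matrix.mul_assoc]
      change rowsOf i (_ * (_ * _)) x y = rowsOf i _ x y
      rw [rowsOf_Upoly_mul]
      change (rowsOf i (Yzero s i + δ t) *
        rowsOf i (Vpoly D Ξ Sg i (root i t) (E t) * (Yzero s i + δ t))) x y = _
      rw [htr, Matrix.one_mul]
    · have := congrFun (congrFun ht p) y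
      simp only [F, hp, if_false] at this
      exact sub_eq_zero.1 this
  -- Θ̂ is a differentiable function of (z, E, δ) with value Θ_ρ at the base point, and all three
  -- arguments are within O(t^{1/ρ}) of it.
  · have hd := ((contDiff_rowsOf ρ hV).differentiable (by norm_num)
      ((0, Sgᴴ * D * Ξ), 0)).hasFDerivAt.isBigO_sub
    have hx : (fun t => ((((root ρ t : ℂ), E t), δ t) :
        (ℂ × Matrix J J ℂ) × Matrix J (Blk s ρ) ℂ) - ((0, Sgᴴ * D * Ξ), 0)) =O[𝓝[>] 0] root ρ := by
      rw [show (fun t => ((((root ρ t : ℂ), E t), δ t) :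
        (ℂ × Matrix J J ℂ) × Matrix J (Blk s ρ) ℂ) - ((0, Sgᴴ * D * Ξ), 0)) =
        fun t => (((root ρ t : ℂ), E t) - (0, Sgᴴ * D * Ξ), δ t) from by
          ext t : 1; rw [Prod.mk_sub_mk, sub_zero]]
      exact hpr.prod_left hδ1
    have ht := tendsto_sub_nhds_zero_iff.1 (hx.trans_tendsto (tendsto_root ρ))
    have := (hd.comp_tendsto ht).trans hx
    simp only [Function.comp_def, add_zero, rowsOf_Vpoly_zero_mul_Yzero] at this
    exact isBigO_matrix.1 this

end Implicit

/-! ### Generalized eigenspaces and the quotient pencil -/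

section Spectral

/-- Since h intertwines lam + z g with f, one has (f - lam - zμ)^j h = z^j h (g - μ)^j. -/
theorem map_mem_maxGenEigenspace {V V' : Type*} [AddCommGroup V] [Module ℂ V] [AddCommGroup V']
    [Module ℂ V'] {f : Module.End ℂ V} {g : Module.End ℂ V'} {h : V' →ₗ[ℂ] V} {lam z : ℂ}
    (hfg : ∀ x, f (h x) = lam • h x + z • h (g x)) {μ : ℂ} {x : V'}
    (hx : x ∈ g.maxGenEigenspace μ) : h x ∈ f.maxGenEigenspace (lam + z * μ) := by
  rw [Module.End.mem_maxGenEigenspace] at hx ⊢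
  obtain ⟨j, hj⟩ := hx
  refine ⟨j, ?_⟩
  have key : ∀ (j : ℕ) (x : V'), ((f - (lam + z * μ) • (1 : Module.End ℂ V)) ^ j) (h x) =
      z ^ j • h (((g - μ • (1 : Module.End ℂ V')) ^ j) x) := by
    intro j
    induction j with
    | zero => intro x; simp
    | succ j ih =>
      intro x
      have h1 : (f - (lam + z * μ) • (1 : Module.End ℂ V)) (h x) =
          z • h ((g - μ • (1 : Module.End ℂ V')) x) := by
        simp only [LinearMap.sub_apply, LinearMap.smul_apply, Module.End.one_apply, hfg, map_sub,
          map_smul, smul_sub, add_smul, smul_smul, LinearMap.add_apply]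
        abel
      rw [pow_succ, Module.End.mul_apply, h1, map_smul, ih, smul_smul, pow_succ, pow_succ,
        Module.End.mul_apply, mul_comm]
  rw [key, hj, map_zero, smul_zero]

/-- For invariant S the hypothesis says that μ is not an eigenvalue on V / S. It is applied
repeatedly, starting from a power of f - μ that kills the vector. -/
theorem maxGenEigenspace_le_of_quotient {V : Type*} [AddCommGroup V] [Module ℂ V]
    {f : Module.End ℂ V} {S : Submodule ℂ V} {μ : ℂ} (h : ∀ v, f v - μ • v ∈ S → v ∈ S) :
    f.maxGenEigenspace μ ≤ S := by
  intro x hx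
  rw [Module.End.mem_maxGenEigenspace] at hx
  obtain ⟨j, hj⟩ := hx
  have key : ∀ (j : ℕ) (x : V), ((f - μ • (1 : Module.End ℂ V)) ^ j) x ∈ S → x ∈ S := by
    intro j
    induction j with
    | zero => intro x hx; simpa using hx
    | succ j ih =>
      intro x hx
      rw [pow_succ, Module.End.mul_apply] at hx
      exact h x (by simpa using ih _ hx)
  exact key j x (by rw [hj]; exact S.zero_mem)

theorem norm_mulVec_le {β : Type*} [Fintype β] {Q : Matrix β β ℂ} {b : ℝ}
    (hQ : ∀ x y, ‖Q x y‖ ≤ b) (hb : 0 ≤ b) (v : β → ℂ) :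
    ‖Q *ᵥ v‖ ≤ Fintype.card β * b * ‖v‖ := by
  rw [pi_norm_le_iff_of_nonneg (by positivity)]
  intro x
  refine (norm_sum_le _ _).trans ?_
  rw [mul_assoc, ← nsmul_eq_mul]
  refine Finset.sum_le_card_nsmul _ _ _ fun y _ => ?_
  rw [norm_mul]
  exact mul_le_mul (hQ x y) (norm_le_pi_norm v y) (norm_nonneg _) hb

theorem norm_eigenvalue_le {β : Type*} [Fintype β] [DecidableEq β] {Q : Matrix β β ℂ} {b : ℝ}
    (hQ : ∀ x y, ‖Q x y‖ ≤ b) (hb : 0 ≤ b) {μ : ℂ}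
    (hμ : Module.End.HasEigenvalue (Matrix.toLin' Q) μ) : ‖μ‖ ≤ Fintype.card β * b := by
  obtain ⟨v, hv⟩ := hμ.exists_hasEigenvector
  have h1 : Q *ᵥ v = μ • v := hv.apply_eq_smul
  have h2 := norm_mulVec_le hQ hb v
  rw [h1, norm_smul] at h2
  exact le_of_mul_le_mul_right h2 (norm_pos_iff.2 hv.2)

/-- An entrywise bound for the inverse keeps the eigenvalues away from zero. -/
theorem one_le_norm_eigenvalue {β : Type*} [Fintype β] [DecidableEq β] {Q : Matrix β β ℂ} {b : ℝ}
    (hu : IsUnit Q) (hQ : ∀ x y, ‖Q⁻¹ x y‖ ≤ b) (hb : 0 ≤ b) {μ : ℂ}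
    (hμ : Module.End.HasEigenvalue (Matrix.toLin' Q) μ) : 1 ≤ Fintype.card β * b * ‖μ‖ := by
  obtain ⟨v, hv⟩ := hμ.exists_hasEigenvector
  have h1 : Q *ᵥ v = μ • v := hv.apply_eq_smul
  have h2 := norm_mulVec_le hQ hb (Q *ᵥ v)
  rw [Matrix.mulVec_mulVec, Matrix.nonsing_inv_mul _ ((Matrix.isUnit_iff_isUnit_det _).1 hu),
    Matrix.one_mulVec, h1, norm_smul] at h2
  refine le_of_mul_le_mul_right ?_ (norm_pos_iff.2 hv.2)
  linarith

theorem range_le_spectralSubspace {n : ℕ} {β : Type*} [Fintype β] [DecidableEq β]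
    {M : Matrix (Fin n) (Fin n) ℂ} {X : Matrix (Fin n) β ℂ} {Q : Matrix β β ℂ} {lam : ℂ}
    {z c C : ℝ} (hz : 0 ≤ z) (hX : M * X = X * (lam • (1 : Matrix _ _ ℂ) + (z : ℂ) • Q))
    (hQ : ∀ μ, Module.End.HasEigenvalue (Matrix.toLin' Q) μ → c ≤ ‖μ‖ ∧ ‖μ‖ ≤ C) :
    LinearMap.range (Matrix.toLin' X) ≤ spectralSubspace M lam (c * z) (C * z) := by
  have hfg : ∀ x, Matrix.toLin' M (Matrix.toLin' X x) =
      lam • Matrix.toLin' X x + (z : ℂ) • Matrix.toLin' X (Matrix.toLin' Q x) := by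
    intro x
    simp only [Matrix.toLin'_apply, Matrix.mulVec_mulVec, hX]
    rw [Matrix.mul_add, Matrix.add_mulVec, Matrix.mul_smul, Matrix.mul_smul, Matrix.mul_one,
      Matrix.smul_mulVec, Matrix.smul_mulVec]
  rw [LinearMap.range_eq_map, ← Module.End.iSup_maxGenEigenspace_eq_top (Matrix.toLin' Q),
    Submodule.map_iSup]
  refine iSup_le fun μ => ?_
  rintro _ ⟨x, hx, rfl⟩
  by_cases hμ : Module.End.HasEigenvalue (Matrix.toLin' Q) μ
  · have h1 := map_mem_maxGenEigenspace hfg hx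
    refine (le_iSup₂_of_le (f := fun μ (_ : μ ∈ {μ : ℂ | c * z ≤ ‖μ - lam‖ ∧ ‖μ - lam‖ ≤ C * z}) =>
      Module.End.maxGenEigenspace (Matrix.toLin' M) μ) (lam + z * μ) ?_ le_rfl) h1
    have h2 := hQ μ hμ
    simp only [Set.mem_ofPred_eq, add_sub_cancel_left, norm_mul, Complex.norm_real,
      Real.norm_of_nonneg hz]
    constructor <;> nlinarith
  · have : Module.End.maxGenEigenspace (Matrix.toLin' Q) μ = ⊥ := by
      by_contra hne
      exact hμ (by
        rw [Module.End.hasEigenvalue_iff]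
        intro h0
        apply hne
        rw [eq_bot_iff]
        refine maxGenEigenspace_le_of_quotient fun v hv => ?_
        have h1 : v ∈ Module.End.eigenspace (Matrix.toLin' Q) μ := by
          rw [Module.End.mem_eigenspace_iff]
          exact sub_eq_zero.1 hv
        rwa [h0] at h1)
    rw [this] at hx
    obtain rfl : x = 0 := hx
    simp

/-- Kernel vectors are taken as one-column matrices, so that `eq_zero_of_leading_pencil` applies to
them. -/
theorem isUnit_of_mul_col {α : Type*} [Fintype α] [DecidableEq α] {K : Matrix α α ℂ}
    (h : ∀ w : Matrix α Unit ℂ, K * w = 0 → w = 0) : IsUnit K := by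
  rw [← Matrix.mulVec_injective_iff_isUnit, ← Matrix.coe_mulVecLin, injective_iff_map_eq_zero]
  intro v hv
  have := h (fun p _ => v p) (by
    ext p y
    exact congrFun hv p)
  ext p
  exact congrFun (congrFun this p) ()

theorem isCompact_annulus (c C : ℝ) : IsCompact {μ : ℂ | c ≤ ‖μ‖ ∧ ‖μ‖ ≤ C} := by
  refine (isCompact_closedBall (0 : ℂ) C).of_isClosed_subset ?_ fun μ hμ => by simpa using hμ.2
  exact (isClosed_le continuous_const continuous_norm).inter
    (isClosed_le continuous_norm continuous_const)

theorem eventually_isUnit_of_isCompact {V α : Type*} [TopologicalSpace V] [Fintype α]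
    [DecidableEq α] {f : V × ℂ → Matrix α α ℂ} (hf : Continuous f) {S : Set ℂ} (hS : IsCompact S)
    {p₀ : V} (h₀ : ∀ μ ∈ S, IsUnit (f (p₀, μ))) :
    ∀ᶠ p in 𝓝 p₀, ∀ μ ∈ S, IsUnit (f (p, μ)) := by
  refine hS.eventually_forall_of_forall_eventually fun μ hμ => ?_
  have h1 : (f (p₀, μ)).det ≠ 0 := ((Matrix.isUnit_iff_isUnit_det _).1 (h₀ μ hμ)).ne_zero
  filter_upwards [hf.matrix_det.continuousAt.eventually_ne h1] with x hx
  exact (Matrix.isUnit_iff_isUnit_det _).2 hx.isUnit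

variable {n k : ℕ} {s : ℕ → ℕ}
variable (D : Matrix (Fin n) (Fin n) ℂ) (Ξ Sg : Matrix (Fin n) (JIdx k s) ℂ) (ρ : Size k)

/-- G - 1 has square zero. -/
theorem G_mul_two_sub_G : G D Ξ Sg ρ * (2 - G D Ξ Sg ρ) = 1 := by
  have h : G D Ξ Sg ρ * (G D Ξ Sg ρ - 1) = G D Ξ Sg ρ - 1 := by
    refine G_mul_of_zero _ _ _ _ _ fun p hp q => ?_
    have : ¬ (ρ.1 + 1 ≤ p.1.1 ∧ p.2.1 = fst p.1 ∧ q.1.1 ≤ ρ.1 ∧ q.2.1 = fst q.1) := by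
      rintro ⟨h1, -⟩; omega
    simp only [G, Matrix.sub_apply]
    rw [dif_neg this, Matrix.one_apply, add_zero, sub_self]
  have h2 : (2 : Matrix (JIdx k s) (JIdx k s) ℂ) - G D Ξ Sg ρ = 1 - (G D Ξ Sg ρ - 1) := by
    rw [sub_sub_eq_add_sub, one_add_one_eq_two]
  rw [h2, mul_sub, h, mul_one, sub_sub_cancel]

/-- The matrix of the scaled pencil `V̂ - μ Û` modulo a subspace spanned by the columns of `Y`,
with the identity in the rows that belong to `ρ`. -/
noncomputable def quotientPencil (z : ℂ) (E : Matrix (JIdx k s) (JIdx k s) ℂ)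
    (Y : Matrix (JIdx k s) (Blk s ρ) ℂ) (μ : ℂ) : Matrix (JIdx k s) (JIdx k s) ℂ := fun p q =>
  if p.1 = ρ then (1 : Matrix (JIdx k s) (JIdx k s) ℂ) p q else
    ((Vpoly D Ξ Sg ρ z E - μ • Upoly D Ξ Sg ρ z) -
      Upoly D Ξ Sg ρ z * Y * rowsOf ρ (Vpoly D Ξ Sg ρ z E - μ • Upoly D Ξ Sg ρ z)) p q

section

attribute [local instance] Matrix.normedAddCommGroup Matrix.normedSpace

theorem continuous_quotientPencil :
    Continuous fun x : ((ℂ × Matrix (JIdx k s) (JIdx k s) ℂ) × Matrix (JIdx k s) (Blk s ρ) ℂ) × ℂ =>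
      quotientPencil D Ξ Sg ρ x.1.1.1 x.1.1.2 x.1.2 x.2 := by
  have hU := (contDiff_Upoly D Ξ Sg ρ).continuous
  have hV := (contDiff_Vpoly D Ξ Sg ρ).continuous
  have hU' : Continuous fun x : ((ℂ × Matrix (JIdx k s) (JIdx k s) ℂ) ×
      Matrix (JIdx k s) (Blk s ρ) ℂ) × ℂ => Upoly D Ξ Sg ρ x.1.1.1 := by fun_prop
  have hV' : Continuous fun x : ((ℂ × Matrix (JIdx k s) (JIdx k s) ℂ) ×
      Matrix (JIdx k s) (Blk s ρ) ℂ) × ℂ => Vpoly D Ξ Sg ρ x.1.1.1 x.1.1.2 :=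
    hV.comp (continuous_fst.comp continuous_fst)
  have h1 := hV'.sub (continuous_snd.smul hU')
  have h2 : Continuous fun x : ((ℂ × Matrix (JIdx k s) (JIdx k s) ℂ) ×
      Matrix (JIdx k s) (Blk s ρ) ℂ) × ℂ =>
        rowsOf ρ (Vpoly D Ξ Sg ρ x.1.1.1 x.1.1.2 - x.2 • Upoly D Ξ Sg ρ x.1.1.1) :=
    continuous_pi fun i => continuous_pi fun j =>
      (continuous_apply j).comp ((continuous_apply _).comp h1)
  have h3 := h1.sub ((hU'.matrix_mul (continuous_snd.comp continuous_fst)).matrix_mul h2)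
  refine continuous_pi fun p => continuous_pi fun q => ?_
  by_cases hp : p.1 = ρ
  · simp only [quotientPencil, hp, if_true]
    exact continuous_const
  · simp only [quotientPencil, hp, if_false]
    exact (continuous_apply q).comp ((continuous_apply p).comp h3)

end

variable {D Ξ Sg ρ}

theorem quotientPencil_mul_apply_of_ne {β : Type*} (z : ℂ) (E : Matrix (JIdx k s) (JIdx k s) ℂ)
    (Y : Matrix (JIdx k s) (Blk s ρ) ℂ) (μ : ℂ) (w : Matrix (JIdx k s) β ℂ) {p : JIdx k s}
    (hp : p.1 ≠ ρ) (y : β) :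
    (quotientPencil D Ξ Sg ρ z E Y μ * w) p y =
      ((Vpoly D Ξ Sg ρ z E - μ • Upoly D Ξ Sg ρ z) * w - Upoly D Ξ Sg ρ z * Y *
        rowsOf ρ ((Vpoly D Ξ Sg ρ z E - μ • Upoly D Ξ Sg ρ z) * w)) p y := by
  have : rowsOf ρ ((Vpoly D Ξ Sg ρ z E - μ • Upoly D Ξ Sg ρ z) * w) =
    rowsOf ρ (Vpoly D Ξ Sg ρ z E - μ • Upoly D Ξ Sg ρ z) * w := rfl
  rw [this, ← Matrix.mul_assoc, ← Matrix.sub_mul, Matrix.mul_apply, Matrix.mul_apply]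
  simp only [quotientPencil, hp, if_false]

theorem rowsOf_quotientPencil_mul {β : Type*} (z : ℂ) (E : Matrix (JIdx k s) (JIdx k s) ℂ)
    (Y : Matrix (JIdx k s) (Blk s ρ) ℂ) (μ : ℂ) (w : Matrix (JIdx k s) β ℂ) :
    rowsOf ρ (quotientPencil D Ξ Sg ρ z E Y μ * w) = rowsOf ρ w := by
  ext x y
  have : (quotientPencil D Ξ Sg ρ z E Y μ * w) ⟨ρ, x⟩ y =
      ((1 : Matrix (JIdx k s) (JIdx k s) ℂ) * w) ⟨ρ, x⟩ y := by
    rw [Matrix.mul_apply, Matrix.mul_apply]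
    simp only [quotientPencil, if_true]
  rw [Matrix.one_mul] at this
  exact this

/-- At z = 0 the correction by Û Y has no rows outside ρ, which leaves V̂(0) - μ Û(0) there. A
kernel vector satisfies the leading pencil equation with the scalar μ as right factor. -/
theorem isUnit_quotientPencil_zero (hW' : IsUnit (W D Ξ Sg (ρ.1 + 1))) {μ : ℂ} (hμ : μ ≠ 0) :
    IsUnit (quotientPencil D Ξ Sg ρ 0 (Sgᴴ * D * Ξ) (Yzero s ρ) μ) := by
  refine isUnit_of_mul_col fun w hw => ?_
  have hQ : IsUnit (μ • (1 : Matrix Unit Unit ℂ)) :=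
    (Matrix.isUnit_iff_isUnit_det _).2 (by simpa using hμ)
  refine eq_zero_of_leading_pencil hW' hQ ?_ fun p hp y => ?_
  · rw [← rowsOf_quotientPencil_mul 0 (Sgᴴ * D * Ξ) (Yzero s ρ) μ w, hw]
    rfl
  · have h1 := quotientPencil_mul_apply_of_ne (D := D) (Ξ := Ξ) (Sg := Sg) 0 (Sgᴴ * D * Ξ)
      (Yzero s ρ) μ w hp y
    rw [hw, Upoly_zero_mul_Yzero, Matrix.sub_apply, Yzero_mul_apply_of_ne _ _ hp, sub_zero,
      Matrix.sub_mul, Matrix.sub_apply, Matrix.zero_apply, Matrix.smul_mul] at h1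
    rw [Matrix.mul_smul, Matrix.mul_one]
    exact (sub_eq_zero.1 h1.symm).symm

/-- If `Y` spans a deflating subspace and `quotientPencil` is invertible, then no vector outside
that subspace is mapped by `V̂ - μ Û` to the image of the subspace. -/
theorem eq_zero_of_quotientPencil {β : Type*} {z : ℂ} {E : Matrix (JIdx k s) (JIdx k s) ℂ}
    {Y : Matrix (JIdx k s) (Blk s ρ) ℂ} {μ : ℂ} (hK : IsUnit (quotientPencil D Ξ Sg ρ z E Y μ))
    (hY : rowsOf ρ Y = 1) {w : Matrix (JIdx k s) β ℂ} {a : Matrix (Blk s ρ) β ℂ}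
    (hw : rowsOf ρ w = 0)
    (h : (Vpoly D Ξ Sg ρ z E - μ • Upoly D Ξ Sg ρ z) * w = Upoly D Ξ Sg ρ z * Y * a) : w = 0 := by
  have h1 : quotientPencil D Ξ Sg ρ z E Y μ * w = 0 := by
    ext p y
    by_cases hp : p.1 = ρ
    · obtain ⟨i, x⟩ := p
      obtain rfl : i = ρ := hp
      change rowsOf i (quotientPencil D Ξ Sg i z E Y μ * w) x y = 0
      rw [rowsOf_quotientPencil_mul, hw]
      rfl
    · rw [quotientPencil_mul_apply_of_ne _ _ _ _ _ hp, h, Matrix.mul_assoc _ Y a, rowsOf_Upoly_mul]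
      have : rowsOf ρ (Y * a) = rowsOf ρ Y * a := rfl
      rw [this, hY, Matrix.one_mul, Matrix.mul_assoc, sub_self]
  have := Matrix.nonsing_inv_mul_cancel_left _ w ((Matrix.isUnit_iff_isUnit_det _).1 hK)
  rw [← this, h1, Matrix.mul_zero]

end Spectral

/-! ### Block triangularization of A + tD and undoing the scaling -/

section Decoupling

variable {n m k : ℕ} {s : ℕ → ℕ}

theorem eq_add_of_resolution {ν ι κ β : Type*} [Fintype ν] [DecidableEq ν] [Fintype ι]
    [Fintype κ] {Ξ : Matrix ν κ ℂ} {Ξc : Matrix ν ι ℂ} {Sg : Matrix κ ν ℂ} {Sgc : Matrix ι ν ℂ}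
    (h : Ξ * Sg + Ξc * Sgc = 1) (D : Matrix ν ν ℂ) (Q : Matrix ν β ℂ) :
    D * Q = Ξ * (Sg * D * Q) + Ξc * (Sgc * D * Q) := by
  rw [Matrix.mul_assoc Sg, Matrix.mul_assoc Sgc, ← Matrix.mul_assoc Ξ, ← Matrix.mul_assoc Ξc,
    ← Matrix.add_mul, h, Matrix.one_mul]

/-- The Riccati equation decouples the perturbed matrix. -/
theorem perturbed_mul_decoupled {ν ι κ : Type*} [Fintype ν] [DecidableEq ν] [Fintype ι]
    [DecidableEq ι] [Fintype κ] [DecidableEq κ] {A D : Matrix ν ν ℂ} {lam t : ℂ}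
    {Ξ : Matrix ν κ ℂ} {Ξc : Matrix ν ι ℂ} {Sg : Matrix κ ν ℂ} {Sgc : Matrix ι ν ℂ}
    {B : Matrix ι ι ℂ} {M : Matrix κ κ ℂ} {P : Matrix ι κ ℂ}
    (h1 : Ξ * Sg + Ξc * Sgc = 1) (hA : A * Ξ = Ξ * (lam • 1 + M)) (hAc : A * Ξc = Ξc * B)
    (hP : (B + t • (Sgc * D * Ξc)) * P - P * (lam • (1 : Matrix _ _ ℂ) + M + t • (Sg * D * Ξ))
      - t • (P * (Sg * D * Ξc) * P) + t • (Sgc * D * Ξ) = 0) :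
    (A + t • D) * (Ξ + Ξc * P) =
      (Ξ + Ξc * P) * (lam • 1 + (M + t • (Sg * D * Ξ + Sg * D * Ξc * P))) := by
  have h2 : (A + t • D) * (Ξ + Ξc * P) - (Ξ + Ξc * P) *
      (lam • 1 + (M + t • (Sg * D * Ξ + Sg * D * Ξc * P))) =
      Ξc * ((B + t • (Sgc * D * Ξc)) * P - P * (lam • (1 : Matrix _ _ ℂ) + M + t • (Sg * D * Ξ))
      - t • (P * (Sg * D * Ξc) * P) + t • (Sgc * D * Ξ)) := by
    have e1 : (A + t • D) * (Ξ + Ξc * P) = A * Ξ + A * Ξc * P + t • (D * Ξ + D * Ξc * P) := by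
      simp only [Matrix.add_mul, Matrix.mul_add, Matrix.smul_mul, smul_add, Matrix.mul_assoc]
      abel
    rw [e1, hA, hAc, eq_add_of_resolution h1 D Ξ, eq_add_of_resolution h1 D Ξc]
    simp only [Matrix.add_mul, Matrix.mul_add, Matrix.mul_sub, Matrix.smul_mul, Matrix.mul_smul,
      smul_add, Matrix.mul_assoc, Matrix.mul_one]
    abel
  rw [← sub_eq_zero, h2, hP, Matrix.mul_zero]

/-- The second block column in the basis [Ξ + Ξc P, Ξc]: modulo the range of Ξ + Ξc P the perturbed
matrix is a small perturbation of B, whose spectrum avoids λ₀. -/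
theorem perturbed_mul_complement {ν ι κ : Type*} [Fintype ν] [DecidableEq ν] [Fintype ι]
    [DecidableEq ι] [Fintype κ] [DecidableEq κ] {A D : Matrix ν ν ℂ} {t : ℂ}
    {Ξ : Matrix ν κ ℂ} {Ξc : Matrix ν ι ℂ} {Sg : Matrix κ ν ℂ} {Sgc : Matrix ι ν ℂ}
    {B : Matrix ι ι ℂ} (P : Matrix ι κ ℂ)
    (h1 : Ξ * Sg + Ξc * Sgc = 1) (hAc : A * Ξc = Ξc * B) :
    (A + t • D) * Ξc = (Ξ + Ξc * P) * (t • (Sg * D * Ξc)) +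
      Ξc * (B + t • (Sgc * D * Ξc - P * (Sg * D * Ξc))) := by
  rw [Matrix.add_mul, Matrix.smul_mul, eq_add_of_resolution h1 D, hAc]
  simp only [Matrix.add_mul, Matrix.mul_add, Matrix.mul_sub, Matrix.mul_smul,
      smul_add, smul_sub, Matrix.mul_assoc]
  abel

theorem L_mul_cancel {β : Type*} (ρ : Size k) {z : ℂ} (hz : z ≠ 0) {M M' : Matrix (JIdx k s) β ℂ}
    (h : L s ρ z * M = L s ρ z * M') : M = M' := by
  ext p y
  have := congrFun (congrFun h p) y
  rw [L, Matrix.diagonal_mul, Matrix.diagonal_mul] at this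
  exact mul_left_cancel₀ (inv_ne_zero (pow_ne_zero _ hz)) this

variable {D : Matrix (Fin n) (Fin n) ℂ} {Ξ Sg : Matrix (Fin n) (JIdx k s) ℂ} {ρ : Size k}

/-- The deflating subspace of the scaled pencil in the original coordinates. -/
theorem unscaled_of_deflating {z : ℂ} (hz : z ≠ 0) {E : Matrix (JIdx k s) (JIdx k s) ℂ}
    {Y : Matrix (JIdx k s) (Blk s ρ) ℂ} {Q : Matrix (Blk s ρ) (Blk s ρ) ℂ}
    (h : Upoly D Ξ Sg ρ z * Y * Q = Vpoly D Ξ Sg ρ z E * Y) :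
    (N k s + z ^ ρ.1 • E) * (R s ρ z * G D Ξ Sg ρ * Y) =
      z • (R s ρ z * G D Ξ Sg ρ * Y * Q) := by
  rw [← Uhat_eq_Upoly D Ξ Sg ρ hz, ← Vhat_eq_Vpoly D Ξ Sg ρ hz, Uhat, Vhat] at h
  refine L_mul_cancel ρ hz ?_
  simp only [Matrix.mul_assoc, Matrix.mul_smul, Matrix.smul_mul, Matrix.one_mul] at h ⊢
  exact h.symm

theorem R_mul_inv (ρ : Size k) {z : ℂ} (hz : z ≠ 0) :
    R s ρ z * Matrix.diagonal (fun p : JIdx k s => (z ^ ((p.2.1 : ℕ) - (p.1.1 - ρ.1)))⁻¹) = 1 := by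
  rw [R, Matrix.diagonal_mul_diagonal, ← Matrix.diagonal_one]
  congr 1
  ext p
  exact mul_inv_cancel₀ (pow_ne_zero _ hz)

/-- If no vector outside the range of `Y` is mapped into it by the scaled pencil, then the same
holds for the unscaled matrix and `R G Y`. -/
theorem exists_eq_unscaled {β : Type*} {z : ℂ} (hz : z ≠ 0)
    {E : Matrix (JIdx k s) (JIdx k s) ℂ}
    {Y : Matrix (JIdx k s) (Blk s ρ) ℂ} {Q : Matrix (Blk s ρ) (Blk s ρ) ℂ}
    (h : Upoly D Ξ Sg ρ z * Y * Q = Vpoly D Ξ Sg ρ z E * Y) (hY : rowsOf ρ Y = 1)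
    {μ : ℂ} (hK : IsUnit (quotientPencil D Ξ Sg ρ z E Y μ)) {v : Matrix (JIdx k s) β ℂ}
    {a : Matrix (Blk s ρ) β ℂ}
    (hv : (N k s + z ^ ρ.1 • E) * v - (z * μ) • v = R s ρ z * G D Ξ Sg ρ * Y * a) :
    ∃ b : Matrix (Blk s ρ) β ℂ, v = R s ρ z * G D Ξ Sg ρ * Y * b := by
  -- R G is invertible: R is diagonal with nonzero entries and G has the inverse 2 - G.
  obtain ⟨y, rfl⟩ : ∃ y : Matrix (JIdx k s) β ℂ, v = R s ρ z * G D Ξ Sg ρ * y := by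
    refine ⟨(2 - G D Ξ Sg ρ) * (Matrix.diagonal
      (fun p : JIdx k s => (z ^ ((p.2.1 : ℕ) - (p.1.1 - ρ.1)))⁻¹) * v), ?_⟩
    rw [Matrix.mul_assoc, ← Matrix.mul_assoc (G D Ξ Sg ρ), G_mul_two_sub_G, Matrix.one_mul,
      ← Matrix.mul_assoc, R_mul_inv ρ hz, Matrix.one_mul]
  refine ⟨rowsOf ρ y, ?_⟩
  have hy : rowsOf ρ (y - Y * rowsOf ρ y) = 0 := by
    have : rowsOf ρ (y - Y * rowsOf ρ y) = rowsOf ρ y - rowsOf ρ Y * rowsOf ρ y := rfl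
    rw [this, hY, Matrix.one_mul, sub_self]
  have h2 : L s ρ z * ((N k s + z ^ ρ.1 • E) * (R s ρ z * G D Ξ Sg ρ * y) -
      (z * μ) • (R s ρ z * G D Ξ Sg ρ * y)) =
      (Vpoly D Ξ Sg ρ z E - μ • Upoly D Ξ Sg ρ z) * y := by
    rw [← Uhat_eq_Upoly D Ξ Sg ρ hz, ← Vhat_eq_Vpoly D Ξ Sg ρ hz, Uhat, Vhat]
    simp only [Matrix.mul_assoc, Matrix.mul_smul, Matrix.smul_mul, Matrix.one_mul, Matrix.mul_sub,
      Matrix.sub_mul, smul_smul, mul_comm]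
  have h3 : L s ρ z * (R s ρ z * G D Ξ Sg ρ * Y * a) =
      Upoly D Ξ Sg ρ z * Y * (z⁻¹ • a) := by
    rw [← Uhat_eq_Upoly D Ξ Sg ρ hz, Uhat]
    simp only [Matrix.mul_assoc, Matrix.mul_smul, Matrix.smul_mul, Matrix.one_mul, smul_smul,
      inv_mul_cancel₀ hz, one_smul]
  have h4 : y - Y * rowsOf ρ y = 0 := by
    -- The factor z⁻¹ comes from L R G = z⁻¹ Û; the second term is the image of Y under V̂ - μ Û,
    -- which is Û Y (Q - μ).
    refine eq_zero_of_quotientPencil hK hY hy (a := z⁻¹ • a - (Q - μ • 1) * rowsOf ρ y) ?_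
    rw [Matrix.mul_sub, ← h2, hv, h3, Matrix.mul_sub]
    congr 1
    rw [← Matrix.mul_assoc, Matrix.sub_mul _ _ Y, ← h, Matrix.smul_mul, Matrix.sub_mul Q,
      Matrix.mul_sub _ _ (_ * _), Matrix.sub_mul, Matrix.smul_mul, Matrix.smul_mul,
      Matrix.one_mul, Matrix.mul_smul]
    simp only [Matrix.mul_assoc]
  rw [Matrix.mul_assoc _ Y, ← sub_eq_zero.1 h4]

end Decoupling

/-! ### Orders of the block rows of R G Y -/

section Orders

variable {k : ℕ} {s : ℕ → ℕ} {ρ : Size k}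
variable {Z : ℝ → Matrix (JIdx k s) (Blk s ρ) ℂ} {Q : ℝ → Matrix (Blk s ρ) (Blk s ρ) ℂ}
variable {E : ℝ → Matrix (JIdx k s) (JIdx k s) ℂ}

theorem isBigO_root_coe_pow (ρ : Size k) (j : ℕ) :
    (fun t => (root ρ t : ℂ) ^ j) =O[𝓝[>] 0] fun t => root ρ t ^ j :=
  (IsBigO.of_bound 1 (Eventually.of_forall fun t => by simp)).pow j

theorem isBigO_of_root_mul {f : ℝ → ℂ} {j : ℕ}
    (h : (fun t => (root ρ t : ℂ) * f t) =O[𝓝[>] 0] fun t => root ρ t ^ (j + 1)) :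
    f =O[𝓝[>] 0] fun t => root ρ t ^ j := by
  have h1 : (fun t => (root ρ t : ℂ)⁻¹) =O[𝓝[>] 0] fun t => (root ρ t)⁻¹ :=
    IsBigO.of_bound 1 (Eventually.of_forall fun t => by simp)
  refine (h1.mul h).congr' ?_ ?_ <;> filter_upwards [self_mem_nhdsWithin] with t ht
  · have : (root ρ t : ℂ) ≠ 0 := by exact_mod_cast (root_pos ρ ht).ne'
    field_simp
  · have := (root_pos ρ ht).ne'
    field_simp
    ring

theorem isBigO_perturbation (hZ : ∀ p y, (fun t => Z t p y) =O[𝓝[>] 0] fun _ => (1 : ℝ))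
    (hE : ∀ p q, (fun t => E t p q) =O[𝓝[>] 0] fun _ => (1 : ℝ)) (p : JIdx k s) (y : Blk s ρ) :
    (fun t => (root ρ t : ℂ) ^ ρ.1 * (E t * Z t) p y) =O[𝓝[>] 0] fun t => root ρ t ^ ρ.1 := by
  have h1 := isBigO_mul_apply (f := E) (g := Z) (fun q => hE p q) fun q => hZ q y
  simpa using (isBigO_root_coe_pow ρ ρ.1).mul h1

/-- Row ℓ of the relation reads Z_{ℓ+1} = z (Z Q)_ℓ - z^ρ (E Z)_ℓ, so each block row gains a factor
z until the perturbation caps the order at z^ρ. -/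
theorem isBigO_of_unscaled (hZ : ∀ p y, (fun t => Z t p y) =O[𝓝[>] 0] fun _ => (1 : ℝ))
    (hE : ∀ p q, (fun t => E t p q) =O[𝓝[>] 0] fun _ => (1 : ℝ))
    (hQ : ∀ x y, (fun t => Q t x y) =O[𝓝[>] 0] fun _ => (1 : ℝ))
    (h : ∀ᶠ t in 𝓝[>] 0, (N k s + (root ρ t : ℂ) ^ ρ.1 • E t) * Z t =
      (root ρ t : ℂ) • (Z t * Q t)) (i : Size k) (l : ℕ) (hl : l < i.1) (a : Fin (s i.1))
    (y : Blk s ρ) :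
    (fun t => Z t ⟨i, ⟨l, hl⟩, a⟩ y) =O[𝓝[>] 0] fun t => root ρ t ^ min l ρ.1 := by
  induction l generalizing a y with
  | zero => simpa using hZ ⟨i, ⟨0, hl⟩, a⟩ y
  | succ l ih =>
    have hl' : l < i.1 := by omega
    have h1 := isBigO_mul_apply (f := Z) (g := Q) (fun x => ih hl' a x) fun x => hQ x y
    have h2 := (isBigO_root_coe_pow ρ 1).mul h1
    have h3 := isBigO_perturbation hZ hE ⟨i, ⟨l, hl'⟩, a⟩ y
    have h2' := (h2.congr_right (g₂ := fun t => root ρ t ^ (1 + min l ρ.1)) fun t => by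
      rw [mul_one, ← pow_add]).trans
      (isBigO_root_pow ρ (show min (l + 1) ρ.1 ≤ 1 + min l ρ.1 by omega))
    have h3' := h3.trans (isBigO_root_pow ρ (show min (l + 1) ρ.1 ≤ ρ.1 by omega))
    refine (h2'.sub h3').congr' ?_ EventuallyEq.rfl
    filter_upwards [h] with t ht
    have := congrFun (congrFun ht ⟨i, ⟨l, hl'⟩, a⟩) y
    rw [Matrix.add_mul, Matrix.add_apply, N_mul_apply_of_lt _ hl, Matrix.smul_mul,
      Matrix.smul_apply, Matrix.smul_apply, smul_eq_mul, smul_eq_mul] at this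
    rw [pow_one, ← this, add_sub_cancel_right]

/-- For sizes below ρ the recursion z (Z Q)_ℓ = Z_{ℓ+1} + O(z^ρ) is run upwards, using the bounded
inverse of Q. The last block row has order z^{ρ-1}, and each step up costs one power. -/
theorem isBigO_of_unscaled_of_lt (hZ : ∀ p y, (fun t => Z t p y) =O[𝓝[>] 0] fun _ => (1 : ℝ))
    (hE : ∀ p q, (fun t => E t p q) =O[𝓝[>] 0] fun _ => (1 : ℝ))
    (hQ : ∀ x y, (fun t => (Q t)⁻¹ x y) =O[𝓝[>] 0] fun _ => (1 : ℝ))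
    (hu : ∀ᶠ t in 𝓝[>] 0, IsUnit (Q t))
    (h : ∀ᶠ t in 𝓝[>] 0, (N k s + (root ρ t : ℂ) ^ ρ.1 • E t) * Z t =
      (root ρ t : ℂ) • (Z t * Q t)) (i : Size k) (hi : i.1 < ρ.1) (d : ℕ) (l : Fin i.1)
    (hl : (l : ℕ) + d + 1 = i.1) (a : Fin (s i.1)) (y : Blk s ρ) :
    (fun t => Z t ⟨i, l, a⟩ y) =O[𝓝[>] 0] fun t => root ρ t ^ (ρ.1 - i.1 + l) := by
  have step : ∀ (l : Fin i.1) (a : Fin (s i.1)), (∀ x, (fun t => (N k s * Z t) ⟨i, l, a⟩ x)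
      =O[𝓝[>] 0] fun t => root ρ t ^ (ρ.1 - i.1 + l + 1)) → ∀ y,
      (fun t => Z t ⟨i, l, a⟩ y) =O[𝓝[>] 0] fun t => root ρ t ^ (ρ.1 - i.1 + l) := by
    intro l a hN y
    have h2 : ∀ x, (fun t => (Z t * Q t) ⟨i, l, a⟩ x) =O[𝓝[>] 0]
        fun t => root ρ t ^ (ρ.1 - i.1 + l) := by
      intro x
      refine isBigO_of_root_mul ?_
      have h3 := (isBigO_perturbation hZ hE ⟨i, l, a⟩ x).trans
        (isBigO_root_pow ρ (show ρ.1 - i.1 + l + 1 ≤ ρ.1 by omega))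
      refine ((hN x).add h3).congr' ?_ EventuallyEq.rfl
      filter_upwards [h] with t ht
      have := congrFun (congrFun ht ⟨i, l, a⟩) x
      rwa [Matrix.add_mul, Matrix.add_apply, Matrix.smul_mul,
        Matrix.smul_apply, Matrix.smul_apply, smul_eq_mul, smul_eq_mul] at this
    have h4 := isBigO_mul_apply (f := fun t => Z t * Q t) (g := fun t => (Q t)⁻¹) h2
      fun x => hQ x y
    refine h4.congr' ?_ (Eventually.of_forall fun t => mul_one _)
    filter_upwards [hu] with t ht
    rw [Matrix.mul_nonsing_inv_cancel_right _ _ ((Matrix.isUnit_iff_isUnit_det _).1 ht)]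
  induction d generalizing l a y with
  | zero =>
    refine step l a (fun x => (isBigO_zero _ _).congr_left fun t => ?_) y
    rw [N_mul_apply_of_not_lt _ (by omega)]
  | succ d ih =>
    refine step l a (fun x => ?_) y
    refine (ih ⟨l + 1, by omega⟩ (by simp only; omega) a x).congr_left fun t => ?_
    rw [N_mul_apply_of_lt]

end Orders

/-! ### Limits, bounds, and the quotient by the range of X -/

section Assembly

variable {n k : ℕ} {s : ℕ → ℕ}

theorem IsO.tendsto {α β : Type*} {ρ : Size k} {F : ℝ → Matrix α β ℂ} {F₀ : Matrix α β ℂ}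
    (h : IsO (fun t => F t - F₀) (1 / (ρ.1 : ℝ))) : Tendsto F (𝓝[>] 0) (𝓝 F₀) :=
  tendsto_pi_nhds.2 fun x => tendsto_pi_nhds.2 fun y =>
    tendsto_sub_nhds_zero_iff.1 ((h x y).trans_tendsto (tendsto_root ρ))

theorem isBigO_one_of_tendsto {α β : Type*} {l : Filter ℝ} {F : ℝ → Matrix α β ℂ}
    {F₀ : Matrix α β ℂ} (h : Tendsto F l (𝓝 F₀)) (x : α) (y : β) :
    (fun t => F t x y) =O[l] fun _ => (1 : ℝ) :=
  (tendsto_pi_nhds.1 (tendsto_pi_nhds.1 h x) y).isBigO_one ℝ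

theorem exists_entry_bound {α β : Type*} [Fintype α] [Fintype β] {l : Filter ℝ}
    {F : ℝ → Matrix α β ℂ} (h : ∀ x y, (fun t => F t x y) =O[l] fun _ => (1 : ℝ)) :
    ∃ b : ℝ, 0 ≤ b ∧ ∀ᶠ t in l, ∀ x y, ‖F t x y‖ ≤ b := by
  choose c hc using fun x y => (h x y).bound
  refine ⟨∑ x, ∑ y, |c x y|, by positivity, ?_⟩
  filter_upwards [eventually_all.2 fun x => eventually_all.2 fun y => hc x y] with t ht x y
  calc ‖F t x y‖ ≤ |c x y| := (ht x y).trans (by simpa using le_abs_self _)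
    _ ≤ ∑ y, |c x y| := Finset.single_le_sum (f := fun y => |c x y|)
        (fun _ _ => abs_nonneg _) (Finset.mem_univ y)
    _ ≤ _ := Finset.single_le_sum (f := fun x => ∑ y, |c x y|)
        (fun _ _ => by positivity) (Finset.mem_univ x)

theorem eventually_isUnit {α : Type*} [Fintype α] [DecidableEq α] {l : Filter ℝ}
    {Q : ℝ → Matrix α α ℂ} {Q₀ : Matrix α α ℂ} (h : Tendsto Q l (𝓝 Q₀)) (hQ₀ : IsUnit Q₀) :
    ∀ᶠ t in l, IsUnit (Q t) := by
  have h1 : Q₀.det ≠ 0 := ((Matrix.isUnit_iff_isUnit_det _).1 hQ₀).ne_zero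
  filter_upwards [((continuous_id.matrix_det.tendsto Q₀).comp h).eventually_ne h1] with t ht
  exact (Matrix.isUnit_iff_isUnit_det _).2 ht.isUnit

theorem tendsto_matrix_inv {α : Type*} [Fintype α] [DecidableEq α] {l : Filter ℝ}
    {Q : ℝ → Matrix α α ℂ} {Q₀ : Matrix α α ℂ} (h : Tendsto Q l (𝓝 Q₀)) (hQ₀ : IsUnit Q₀) :
    Tendsto (fun t => (Q t)⁻¹) l (𝓝 Q₀⁻¹) := by
  have h1 : Q₀.det ≠ 0 := ((Matrix.isUnit_iff_isUnit_det _).1 hQ₀).ne_zero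
  have hd := (continuous_id.matrix_det.tendsto Q₀).comp h
  have ha := (continuous_id.matrix_adjugate.tendsto Q₀).comp h
  simp only [Matrix.inv_def, Ring.inverse_eq_inv']
  exact (hd.inv₀ h1).smul ha

theorem sum_blockCol_mul {β : Type*} (Ξ : Matrix (Fin n) (JIdx k s) ℂ)
    (M : Matrix (JIdx k s) β ℂ) : ∑ i : Size k, blockCol Ξ i * rowsOf i M = Ξ * M := by
  ext r y
  rw [Matrix.sum_apply, Matrix.mul_apply, Fintype.sum_sigma]
  refine Finset.sum_congr rfl fun i _ => ?_
  rw [Matrix.mul_apply]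
  rfl

/-- A vector that the perturbed matrix maps, modulo a multiple of itself, into the range of
`X = Φ R G Y` belongs to this range. -/
theorem exists_eq_mul_of_quotient {ν ι : Type*} [Fintype ν] [DecidableEq ν] [Fintype ι]
    [DecidableEq ι] {D : Matrix (Fin n) (Fin n) ℂ} {Ξ Sg : Matrix (Fin n) (JIdx k s) ℂ} {ρ : Size k}
    {z : ℂ} (hz : z ≠ 0) {E : Matrix (JIdx k s) (JIdx k s) ℂ}
    {Y : Matrix (JIdx k s) (Blk s ρ) ℂ} {Q : Matrix (Blk s ρ) (Blk s ρ) ℂ}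
    (h : Upoly D Ξ Sg ρ z * Y * Q = Vpoly D Ξ Sg ρ z E * Y) (hY : rowsOf ρ Y = 1)
    {μ lam : ℂ} (hK : IsUnit (quotientPencil D Ξ Sg ρ z E Y μ))
    {M : Matrix ν ν ℂ} {Φ : Matrix ν (JIdx k s) ℂ} {Φc : Matrix ν ι ℂ} {S : Matrix (JIdx k s) ν ℂ}
    {T : Matrix ι ν ℂ} {B : Matrix ι ι ℂ} {C : Matrix (JIdx k s) ι ℂ}
    (hdec : Φ * S + Φc * T = 1) (hSΦ : S * Φ = 1) (hTΦ : T * Φ = 0) (hTc : T * Φc = 1)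
    (hM : M * Φ = Φ * (lam • 1 + (N k s + z ^ ρ.1 • E))) (hMc : M * Φc = Φ * C + Φc * B)
    (hB : IsUnit (B - (lam + z * μ) • 1)) {v : Matrix ν Unit ℂ} {a : Matrix (Blk s ρ) Unit ℂ}
    (hv : M * v - (lam + z * μ) • v = Φ * (R s ρ z * G D Ξ Sg ρ * Y) * a) :
    ∃ b : Matrix (Blk s ρ) Unit ℂ, v = Φ * (R s ρ z * G D Ξ Sg ρ * Y) * b := by
  obtain ⟨w, u, hvd⟩ : ∃ (w : Matrix (JIdx k s) Unit ℂ) (u : Matrix ι Unit ℂ),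
      v = Φ * w + Φc * u := by
    refine ⟨S * v, T * v, ?_⟩
    rw [← Matrix.mul_assoc, ← Matrix.mul_assoc, ← Matrix.add_mul, hdec, Matrix.one_mul]
  have h1 : M * v - (lam + z * μ) • v =
      Φ * ((N k s + z ^ ρ.1 • E) * w - (z * μ) • w + C * u) +
        Φc * ((B - (lam + z * μ) • 1) * u) := by
    have e1 : M * v = Φ * (lam • 1 + (N k s + z ^ ρ.1 • E)) * w + (Φ * C + Φc * B) * u := by
      rw [hvd, Matrix.mul_add, ← Matrix.mul_assoc, ← Matrix.mul_assoc, hM, hMc]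
    rw [e1, hvd]
    simp only [Matrix.add_mul, Matrix.mul_add, Matrix.mul_sub, Matrix.sub_mul, Matrix.smul_mul,
      Matrix.mul_smul, Matrix.mul_assoc, Matrix.one_mul, smul_add, add_smul]
    abel
  rw [h1] at hv
  -- T annihilates Φ and so isolates the complementary component, on which M - (lam + zμ) acts
  -- invertibly.
  have hu0 : u = 0 := by
    have h2 := congrArg (T * ·) hv
    simp only [Matrix.mul_add, ← Matrix.mul_assoc, hTΦ, hTc, Matrix.zero_mul, zero_add,
      Matrix.one_mul] at h2
    have h3 := Matrix.nonsing_inv_mul_cancel_left _ u ((Matrix.isUnit_iff_isUnit_det _).1 hB)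
    rw [← h3, h2, Matrix.mul_zero]
  have hw' : (N k s + z ^ ρ.1 • E) * w - (z * μ) • w = R s ρ z * G D Ξ Sg ρ * Y * a := by
    rw [hu0, Matrix.mul_zero, Matrix.mul_zero, Matrix.mul_zero, add_zero, add_zero,
      Matrix.mul_assoc] at hv
    have h2 := congrArg (S * ·) hv
    simpa only [← Matrix.mul_assoc S, hSΦ, Matrix.one_mul] using h2
  obtain ⟨b, hb⟩ := exists_eq_unscaled hz h hY hK hw'
  refine ⟨b, ?_⟩
  rw [hvd, hu0, hb, Matrix.mul_zero, add_zero, ← Matrix.mul_assoc]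

end Assembly

/-! ### Rank, remainder and leading term of X -/

section Main

variable {n m k : ℕ} {s : ℕ → ℕ}

theorem isBigO_R_apply (ρ : Size k) (p : JIdx k s) (q : JIdx k s) :
    (fun t => R s ρ (root ρ t) p q) =O[𝓝[>] 0] fun _ => (1 : ℝ) := by
  by_cases h : p = q
  · subst h
    simp only [R, Matrix.diagonal_apply_eq]
    refine (isBigO_root_coe_pow ρ _).trans ?_
    simpa using isBigO_root_pow ρ (Nat.zero_le _)
  · simp only [R, Matrix.diagonal_apply_ne _ h]
    exact isBigO_zero _ _

variable {D : Matrix (Fin n) (Fin n) ℂ} {Ξ Sg : Matrix (Fin n) (JIdx k s) ℂ} {ρ : Size k}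

theorem isBigO_unscaled {Y : ℝ → Matrix (JIdx k s) (Blk s ρ) ℂ}
    (hY : ∀ p y, (fun t => Y t p y) =O[𝓝[>] 0] fun _ => (1 : ℝ)) (p : JIdx k s) (y : Blk s ρ) :
    (fun t => (R s ρ (root ρ t) * G D Ξ Sg ρ * Y t) p y) =O[𝓝[>] 0] fun _ => (1 : ℝ) := by
  have h1 : ∀ q, (fun t => (R s ρ (root ρ t) * G D Ξ Sg ρ) p q) =O[𝓝[>] 0] fun _ => (1 : ℝ) := by
    intro q
    simpa using isBigO_mul_apply (f := fun t => R s ρ (root ρ t)) (g := fun _ => G D Ξ Sg ρ)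
      (isBigO_R_apply ρ p) fun x => isBigO_const_const _ one_ne_zero _
  simpa using isBigO_mul_apply h1 fun x => hY x y

theorem unscaled_apply_self {Y : Matrix (JIdx k s) (Blk s ρ) ℂ} (hY : rowsOf ρ Y = 1) (z : ℂ)
    (x y : Blk s ρ) :
    (R s ρ z * G D Ξ Sg ρ * Y) ⟨ρ, x⟩ y =
      z ^ (x.1 : ℕ) * (1 : Matrix (Blk s ρ) (Blk s ρ) ℂ) x y := by
  rw [Matrix.mul_assoc, R, Matrix.diagonal_mul, G_mul_apply_of_not _ _ _ _ _ (by simp), ← hY]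
  simp [rowsOf]

theorem leadAll_self (x y : Blk s ρ) :
    leadAll D Ξ Sg ρ ⟨ρ, x⟩ y =
      if (x.1 : ℕ) = 0 then (1 : Matrix (Blk s ρ) (Blk s ρ) ℂ) x y else 0 := by
  have h := G_mul_Yzero_apply D Ξ Sg ρ ⟨ρ, x⟩ y
  rw [G_mul_apply_of_not _ _ _ _ _ (by simp), Yzero_self] at h
  simp only at h
  split_ifs at h ⊢ with h0
  · rw [h, add_zero]
  · exact right_eq_add.1 h

/-- Multiplication by S recovers R G Y, whose rows of ρ form an invertible diagonal matrix of powers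
of z. -/
theorem linearIndependent_col {Y : Matrix (JIdx k s) (Blk s ρ) ℂ} (hY : rowsOf ρ Y = 1)
    {z : ℂ} (hz : z ≠ 0) {ν : Type*} [Fintype ν] {Φ : Matrix ν (JIdx k s) ℂ}
    {S : Matrix (JIdx k s) ν ℂ} (hSΦ : S * Φ = 1) :
    LinearIndependent ℂ (Φ * (R s ρ z * G D Ξ Sg ρ * Y)).col := by
  rw [← Matrix.mulVec_injective_iff, ← Matrix.coe_mulVecLin, injective_iff_map_eq_zero]
  intro v hv
  rw [Matrix.mulVecLin_apply] at hv
  have h1 := congrArg (S *ᵥ ·) hv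
  simp only [Matrix.mulVec_mulVec, ← Matrix.mul_assoc S, hSΦ, Matrix.one_mul,
    Matrix.mulVec_zero] at h1
  ext x
  have h2 := congrFun h1 ⟨ρ, x⟩
  simp only [Matrix.mulVec, dotProduct, unscaled_apply_self hY, mul_assoc, ← Finset.mul_sum,
    Pi.zero_apply, mul_eq_zero, pow_ne_zero _ hz, false_or] at h2
  simpa [Matrix.one_apply] using h2

/-- R has entry 1 in first block rows, so the difference is G (Y - `Yzero`) there. -/
theorem isBigO_unscaled_sub_leadAll {Y : ℝ → Matrix (JIdx k s) (Blk s ρ) ℂ}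
    (hY : IsO (fun t => Y t - Yzero s ρ) (1 / (ρ.1 : ℝ))) {i : Size k} (l : Fin i.1) (hl : (l : ℕ) = 0) (a : Fin (s i.1)) (y : Blk s ρ) :
    (fun t => (R s ρ (root ρ t) * G D Ξ Sg ρ * Y t - leadAll D Ξ Sg ρ) ⟨i, l, a⟩ y)
      =O[𝓝[>] 0] root ρ := by
  have h1 : ∀ t, (R s ρ (root ρ t) * G D Ξ Sg ρ * Y t - leadAll D Ξ Sg ρ) ⟨i, l, a⟩ y =
      (G D Ξ Sg ρ * (Y t - Yzero s ρ)) ⟨i, l, a⟩ y := by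
    intro t
    rw [Matrix.sub_apply, Matrix.mul_assoc, R, Matrix.diagonal_mul, Matrix.mul_sub,
      Matrix.sub_apply, G_mul_Yzero_apply, if_pos hl, add_zero]
    simp [hl]
  refine IsBigO.congr_left ?_ fun t => (h1 t).symm
  have h2 := isBigO_mul_apply (f := fun _ => G D Ξ Sg ρ) (g := fun t => Y t - Yzero s ρ)
    (l := 𝓝[>] 0) (i := ⟨i, l, a⟩) (j := y) (r₁ := fun _ => 1)
    (fun x => isBigO_const_const _ one_ne_zero _) fun x => hY x y
  exact h2.congr_right fun t => one_mul _

theorem eventually_isUnit_sub_smul {ι : Type*} [Fintype ι] [DecidableEq ι] {B₀ : Matrix ι ι ℂ}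
    {B : ℝ → Matrix ι ι ℂ} {l : Filter ℝ} (hB : Tendsto B l (𝓝 B₀)) {lam : ℂ}
    (hlam : lam ∉ spectrum ℂ B₀) {z : ℝ → ℂ} (hz : Tendsto z l (𝓝 0)) {S : Set ℂ}
    (hS : IsCompact S) : ∀ᶠ t in l, ∀ μ ∈ S, IsUnit (B t - (lam + z t * μ) • 1) := by
  have hcont : Continuous fun x : (ℂ × Matrix ι ι ℂ) × ℂ =>
      x.1.2 - (lam + x.1.1 * x.2) • (1 : Matrix ι ι ℂ) := by fun_prop
  refine (hz.prodMk_nhds hB).eventually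
    (eventually_isUnit_of_isCompact hcont hS (p₀ := (0, B₀)) fun μ _ => ?_)
  rw [spectrum.notMem_iff, Algebra.algebraMap_eq_smul_one] at hlam
  simpa using hlam.neg

theorem isBigO_expansion_remainder {ι ν : Type*} [Fintype ι] (Φc : Matrix ν ι ℂ)
    {P : ℝ → Matrix ι (JIdx k s) ℂ} (hP : IsO P 1) {Z : ℝ → Matrix (JIdx k s) (Blk s ρ) ℂ}
    (hZ : ∀ p y, (fun t => Z t p y) =O[𝓝[>] 0] fun _ => (1 : ℝ)) :
    IsO (fun t => Φc * (P t * Z t)) 1 := by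
  intro x y
  have h1 : ∀ q, (fun t => (P t * Z t) q y) =O[𝓝[>] 0] fun t : ℝ => t ^ (1 : ℝ) := fun q => by
    simpa using isBigO_mul_apply (fun p => hP q p) fun p => hZ p y
  simpa using isBigO_mul_apply (f := fun _ => Φc) (r₁ := fun _ => 1) (i := x)
    (fun q => isBigO_const_const _ one_ne_zero _) h1

end Main

end JordanPert

/-! ### The theorem -/

open JordanPert

theorem theorem3p1
    {n m k : ℕ} (s : ℕ → ℕ) (hs : 0 < s k)
    (A D : Matrix (Fin n) (Fin n) ℂ) (lam : ℂ)
    (Ξ Sg : Matrix (Fin n) (JordanPert.JIdx k s) ℂ)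
    (Ξc Sgc : Matrix (Fin n) (Fin m) ℂ)
    (A₂₂ : Matrix (Fin m) (Fin m) ℂ)
    -- `[Ξ Ξc]` is invertible and `[Sg Sgc]` is the conjugate transpose of its inverse
    (hinv_left : (Matrix.fromCols Sg Sgc)ᴴ * Matrix.fromCols Ξ Ξc = 1)
    (hinv_right : Matrix.fromCols Ξ Ξc * (Matrix.fromCols Sg Sgc)ᴴ = 1)
    (hA : A * Matrix.fromCols Ξ Ξc = Matrix.fromCols Ξ Ξc *
      Matrix.fromBlocks (lam • (1 : Matrix _ _ ℂ) + JordanPert.N k s) 0 0 A₂₂)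
    (hA₂₂ : lam ∉ spectrum ℂ A₂₂)
    (ρ : JordanPert.Size k)
    -- `W_{k+1}` is the empty matrix, so this is a condition on `W_1, …, W_{min(ρ+1,k)}`
    (hW : ∀ i : ℕ, 1 ≤ i → i ≤ ρ.1 + 1 → IsUnit (JordanPert.W D Ξ Sg i)) :
    ∃ (X : ℝ → Matrix (Fin n) (JordanPert.Blk s ρ) ℂ)
      (ThetaHat : ℝ → Matrix (JordanPert.Blk s ρ) (JordanPert.Blk s ρ) ℂ)
      (Xt : ℝ → (i : JordanPert.Size k) → Matrix (JordanPert.Blk s i) (JordanPert.Blk s ρ) ℂ)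
      (P : ℝ → Matrix (Fin m) (JordanPert.JIdx k s) ℂ)
      (Y : ℝ → Matrix (JordanPert.JIdx k s) (JordanPert.Blk s ρ) ℂ),
      -- the invariance relation, with a basis matrix `X`
      (∀ᶠ t : ℝ in 𝓝[>] 0,
        (A + (t : ℂ) • D) * X t
          = X t * (lam • (1 : Matrix _ _ ℂ) + (JordanPert.root ρ t : ℂ) • ThetaHat t) ∧
        LinearIndependent ℂ (X t).col) ∧
      -- the range of `X` belongs to all the eigenvalues of order `t^{1/ρ}`
      (∃ c₀ C₀ : ℝ, 0 < c₀ ∧ 0 < C₀ ∧ ∀ c C : ℝ, 0 < c → c ≤ c₀ → C₀ ≤ C →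
        ∀ᶠ t : ℝ in 𝓝[>] 0,
          LinearMap.range (Matrix.toLin' (X t)) =
            JordanPert.spectralSubspace (A + (t : ℂ) • D) lam
              (c * JordanPert.root ρ t) (C * JordanPert.root ρ t)) ∧
      -- the order of `ThetaHat - Theta`
      JordanPert.IsO (fun t => ThetaHat t - JordanPert.Theta D Ξ Sg ρ) (1 / (ρ.1 : ℝ)) ∧
      -- the expansion of `X`
      JordanPert.IsO (fun t => X t - (JordanPert.tailFirst Ξ ρ.1 * JordanPert.lead D Ξ Sg ρ
        + ∑ i : JordanPert.Size k, JordanPert.blockCol Ξ i * Xt t i)) 1 ∧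
      (∀ᶠ t : ℝ in 𝓝[>] 0, Xt t ρ = Matrix.diagonal fun x =>
        if x.1 = JordanPert.fst ρ then 0 else ((t ^ (((x.1 : ℕ) : ℝ) / (ρ.1 : ℝ)) : ℝ) : ℂ)) ∧
      (∀ i : JordanPert.Size k, i.1 < ρ.1 → ∀ x y,
        (fun t => Xt t i x y) =O[𝓝[>] (0 : ℝ)]
          fun t : ℝ => t ^ (1 - ((i.1 : ℝ) - ((x.1 : ℕ) : ℝ)) / (ρ.1 : ℝ))) ∧
      (∀ i : JordanPert.Size k, ρ.1 < i.1 → ∀ x y,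
        (fun t => Xt t i x y) =O[𝓝[>] (0 : ℝ)]
          fun t : ℝ => t ^ (((min (max (x.1 : ℕ) 1) ρ.1 : ℕ) : ℝ) / (ρ.1 : ℝ))) ∧
      -- the definition of `ThetaHat` and `X` through the scaled pencil:
      -- `P` is the solution of order `t` of the Riccati equation that decouples `lam` from the
      -- other eigenvalues,
      JordanPert.IsO P 1 ∧
      (∀ᶠ t : ℝ in 𝓝[>] 0,
        (A₂₂ + (t : ℂ) • (Sgcᴴ * D * Ξc)) * P t
          - P t * (lam • (1 : Matrix _ _ ℂ) + JordanPert.N k s + (t : ℂ) • (Sgᴴ * D * Ξ))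
          - (t : ℂ) • (P t * (Sgᴴ * D * Ξc) * P t) + (t : ℂ) • (Sgcᴴ * D * Ξ) = 0) ∧
      -- `Y` has block rows `X₁`, `I`, `X₂` with `X₁` and `X₂` of order `t^{1/ρ}`,
      (∀ᶠ t : ℝ in 𝓝[>] 0, ∀ x y, Y t ⟨ρ, x⟩ y = (1 : Matrix _ _ ℂ) x y) ∧
      (∀ p : JordanPert.JIdx k s, p.1 ≠ ρ → ∀ y,
        (fun t => Y t p y) =O[𝓝[>] (0 : ℝ)] fun t : ℝ => t ^ (1 / (ρ.1 : ℝ))) ∧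
      -- it is a matrix of a deflating subspace of the pencil, `ThetaHat` is the block row
      -- of `V̂(z) Y` that belongs to `ρ`, and `X` is obtained from `Y` by undoing the scalings
      (∀ᶠ t : ℝ in 𝓝[>] 0,
        JordanPert.Uhat D Ξ Sg ρ (JordanPert.root ρ t) * Y t * ThetaHat t
          = JordanPert.Vhat D Ξ Sg (Sgᴴ * D * Ξ + Sgᴴ * D * Ξc * P t) ρ
              (JordanPert.root ρ t) * Y t ∧
        (∀ x y, ThetaHat t x y
          = (JordanPert.Vhat D Ξ Sg (Sgᴴ * D * Ξ + Sgᴴ * D * Ξc * P t) ρ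
              (JordanPert.root ρ t) * Y t) ⟨ρ, x⟩ y) ∧
        X t = (Ξ + Ξc * P t) *
          (JordanPert.R s ρ (JordanPert.root ρ t) * JordanPert.G D Ξ Sg ρ * Y t)) := by
  have hWρ : IsUnit (W D Ξ Sg ρ.1) := hW _ ρ.one_le (Nat.le_succ _)
  have hWρ' : IsUnit (W D Ξ Sg (ρ.1 + 1)) := hW _ (Nat.le_add_left _ _) le_rfl
  rw [Matrix.conjTranspose_fromCols_eq_fromRows_conjTranspose, Matrix.fromRows_mul_fromCols,
    ← Matrix.fromBlocks_one, Matrix.fromBlocks_inj] at hinv_left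
  obtain ⟨hSΞ, hSΞc, hScΞ, hScΞc⟩ := hinv_left
  rw [Matrix.conjTranspose_fromCols_eq_fromRows_conjTranspose,
    Matrix.fromCols_mul_fromRows] at hinv_right
  rw [Matrix.mul_fromCols, Matrix.fromCols_mul_fromBlocks, Matrix.fromCols_ext_iff,
    Matrix.mul_zero, Matrix.mul_zero, add_zero, zero_add] at hA
  obtain ⟨hAΞ, hAΞc⟩ := hA
  obtain ⟨P, hPO, hP⟩ := exists_riccati hA₂₂ (isNilpotent_N k s) (Sgᴴ * D * Ξ) (Sgᴴ * D * Ξc)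
    (Sgcᴴ * D * Ξ) (Sgcᴴ * D * Ξc)
  have hP0 : Tendsto P (𝓝[>] 0) (𝓝 0) :=
    IsO.tendsto (ρ := ρ) fun x y => by
      simp only [sub_zero]
      exact (hPO x y).trans (isBigO_id_root ρ)
  set E : ℝ → Matrix (JIdx k s) (JIdx k s) ℂ := fun t => Sgᴴ * D * Ξ + Sgᴴ * D * Ξc * P t with hEdef
  have hE : IsO (fun t => E t - Sgᴴ * D * Ξ) (1 / (ρ.1 : ℝ)) := by
    intro p q
    simp only [hEdef, add_sub_cancel_left]
    have h1 := isBigO_mul_apply (f := fun _ => Sgᴴ * D * Ξc) (g := P) (l := 𝓝[>] 0) (i := p)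
      (j := q) (r₁ := fun _ => 1) (fun x => isBigO_const_const _ one_ne_zero _) fun x => hPO x q
    exact (h1.congr_right fun t => one_mul _).trans (isBigO_id_root ρ)
  obtain ⟨Y, hYrow, hYO, hUV, hΘO⟩ := exists_deflating hWρ hWρ' hE
  set Q : ℝ → Matrix (Blk s ρ) (Blk s ρ) ℂ :=
    fun t => rowsOf ρ (Vpoly D Ξ Sg ρ (root ρ t) (E t) * Y t) with hQdef
  have hQt : Tendsto Q (𝓝[>] 0) (𝓝 (Theta D Ξ Sg ρ)) := hΘO.tendsto
  have hΘ : IsUnit (Theta D Ξ Sg ρ) := isUnit_Theta hWρ hWρ'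
  have hQu := eventually_isUnit hQt hΘ
  have hQ1 := isBigO_one_of_tendsto hQt
  have hQi := isBigO_one_of_tendsto (tendsto_matrix_inv hQt hΘ)
  have hE1 := isBigO_one_of_tendsto hE.tendsto
  have hY1 := isBigO_one_of_tendsto hYO.tendsto
  set Z : ℝ → Matrix (JIdx k s) (Blk s ρ) ℂ :=
    fun t => R s ρ (root ρ t) * G D Ξ Sg ρ * Y t with hZdef
  have hZ1 : ∀ p y, (fun t => Z t p y) =O[𝓝[>] 0] fun _ => (1 : ℝ) := isBigO_unscaled hY1
  have hpos : ∀ᶠ t : ℝ in 𝓝[>] 0, 0 < t := self_mem_nhdsWithin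
  have hne : ∀ {t : ℝ}, 0 < t → (root ρ t : ℂ) ≠ 0 := fun ht => by
    exact_mod_cast (root_pos ρ ht).ne'
  have hpow : ∀ {t : ℝ}, 0 < t → (root ρ t : ℂ) ^ ρ.1 = t := fun ht => by
    exact_mod_cast root_pow_self ρ ht
  have hZeq : ∀ᶠ t in 𝓝[>] 0, (N k s + (root ρ t : ℂ) ^ ρ.1 • E t) * Z t =
      (root ρ t : ℂ) • (Z t * Q t) := by
    filter_upwards [hUV, hpos] with t ht h0
    exact unscaled_of_deflating (hne h0) ht
  have hSΦ : ∀ t, Sgᴴ * (Ξ + Ξc * P t) = 1 := fun t => by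
    rw [Matrix.mul_add, hSΞ, ← Matrix.mul_assoc, hSΞc, Matrix.zero_mul, add_zero]
  have hMΦ : ∀ᶠ t : ℝ in 𝓝[>] 0, (A + (t : ℂ) • D) * (Ξ + Ξc * P t) =
      (Ξ + Ξc * P t) * (lam • 1 + (N k s + (root ρ t : ℂ) ^ ρ.1 • E t)) := by
    filter_upwards [hP, hpos] with t ht h0
    rw [hpow h0]
    exact perturbed_mul_decoupled hinv_right hAΞ hAΞc ht
  have hMX : ∀ᶠ t : ℝ in 𝓝[>] 0, (A + (t : ℂ) • D) * ((Ξ + Ξc * P t) * Z t) =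
      (Ξ + Ξc * P t) * Z t * (lam • (1 : Matrix _ _ ℂ) + (root ρ t : ℂ) • Q t) := by
    filter_upwards [hMΦ, hZeq] with t h1 h2
    rw [← Matrix.mul_assoc, h1, Matrix.mul_assoc, Matrix.add_mul (lam • 1), h2, Matrix.smul_mul,
      Matrix.one_mul, Matrix.mul_assoc _ (Z t), Matrix.mul_add (Z t), Matrix.mul_smul, Matrix.mul_smul,
      Matrix.mul_one]
  -- With the matrices X̃_i taken as the block rows of Z minus the leading part, the only remainder
  -- in the expansion is Ξc P Z = O(t).
  refine ⟨fun t => (Ξ + Ξc * P t) * Z t, Q, fun t i => rowsOf i (Z t - leadAll D Ξ Sg ρ), P, Y,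
    ?_, ?_, hΘO, ?_, ?_, ?_, ?_, hPO, hP, ?_, ?_, ?_⟩
  · filter_upwards [hMX, hYrow, hpos] with t h1 h2 h0
    exact ⟨h1, linearIndependent_col h2 (hne h0) (hSΦ t)⟩
  · obtain ⟨b, hb0, hb⟩ := exists_entry_bound hQ1
    obtain ⟨b', hb0', hb'⟩ := exists_entry_bound hQi
    -- `b` and `b'` bound the entries of Θ̂ and of its inverse, so its eigenvalues lie between c₀
    -- and C₀; the summand 1 keeps both constants positive.
    refine ⟨1 / (Fintype.card (Blk s ρ) * b' + 1), Fintype.card (Blk s ρ) * b + 1, by positivity,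
      by positivity, fun c C hc hc' hC => ?_⟩
    have hS := isCompact_annulus c C
    have hz0 : Tendsto (fun t => (root ρ t : ℂ)) (𝓝[>] 0) (𝓝 0) := by
      have := (Complex.continuous_ofReal.tendsto 0).comp (tendsto_root ρ)
      simpa [Function.comp_def] using this
    have ht0 : Tendsto (fun t : ℝ => (t : ℂ)) (𝓝[>] 0) (𝓝 0) := by
      have := (Complex.continuous_ofReal.tendsto 0).mono_left
        (nhdsWithin_le_nhds (s := Set.Ioi (0 : ℝ)))
      simpa using this
    have hB : Tendsto (fun t : ℝ => A₂₂ + (t : ℂ) •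
        (Sgcᴴ * D * Ξc - P t * (Sgᴴ * D * Ξc))) (𝓝[>] 0) (𝓝 A₂₂) := by
      have hcont : Continuous fun x : ℂ × Matrix (Fin m) (JIdx k s) ℂ =>
          A₂₂ + x.1 • (Sgcᴴ * D * Ξc - x.2 * (Sgᴴ * D * Ξc)) := by fun_prop
      have := (hcont.tendsto (0, 0)).comp (ht0.prodMk_nhds hP0)
      simpa [Function.comp_def] using this
    have hBu := eventually_isUnit_sub_smul hB hA₂₂ hz0 hS
    have hK := ((hz0.prodMk_nhds hE.tendsto).prodMk_nhds hYO.tendsto).eventually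
      (eventually_isUnit_of_isCompact (continuous_quotientPencil D Ξ Sg ρ) hS
        fun μ hμ => isUnit_quotientPencil_zero hWρ' (norm_pos_iff.1 (hc.trans_le hμ.1)))
    filter_upwards [hb, hb', hBu, hK, hQu, hMX, hMΦ, hUV, hYrow, hpos]
      with t hb hb' hBu hK hQu hMX hMΦ hUV hYrow h0
    have hr := root_pos ρ h0
    refine le_antisymm (range_le_spectralSubspace hr.le hMX fun μ hμ => ?_) ?_
    · have h1 := norm_eigenvalue_le hb hb0 hμ
      have h2 := one_le_norm_eigenvalue hQu hb' hb0' hμ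
      refine ⟨hc'.trans ?_, by linarith⟩
      rw [div_le_iff₀ (by positivity)]
      nlinarith [norm_nonneg μ]
    · refine iSup₂_le fun ν hν => maxGenEigenspace_le_of_quotient fun v hv => ?_
      -- Rescaling by t^{1/ρ} moves the eigenvalue into a compact annulus that does not depend on t.
      obtain ⟨μ, rfl⟩ : ∃ μ, ν = lam + root ρ t * μ :=
        ⟨(ν - lam) / root ρ t, by rw [mul_div_cancel₀ _ (hne h0)]; ring⟩
      have hμ : μ ∈ {μ : ℂ | c ≤ ‖μ‖ ∧ ‖μ‖ ≤ C} := by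
        obtain ⟨h1, h2⟩ := hν
        rw [add_sub_cancel_left, norm_mul, Complex.norm_real, Real.norm_of_nonneg hr.le,
          mul_comm _ ‖μ‖] at h1 h2
        exact ⟨le_of_mul_le_mul_right h1 hr, le_of_mul_le_mul_right h2 hr⟩
      obtain ⟨a, ha⟩ := hv
      -- Sgᴴ and Sgcᴴ - P Sgᴴ are the block rows of the inverse of [Ξ + Ξc P, Ξc].
      have hT : (Sgcᴴ - P t * Sgᴴ) * (Ξ + Ξc * P t) = 0 := by
        rw [Matrix.sub_mul, Matrix.mul_assoc (P t), hSΦ, Matrix.mul_one, Matrix.mul_add, hScΞ,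
          ← Matrix.mul_assoc, hScΞc, Matrix.one_mul, zero_add, sub_self]
      have hTc : (Sgcᴴ - P t * Sgᴴ) * Ξc = 1 := by
        rw [Matrix.sub_mul, Matrix.mul_assoc (P t), hSΞc, Matrix.mul_zero, hScΞc, sub_zero]
      have hdec : (Ξ + Ξc * P t) * Sgᴴ + Ξc * (Sgcᴴ - P t * Sgᴴ) = 1 := by
        rw [← hinv_right, Matrix.add_mul, Matrix.mul_sub, Matrix.mul_assoc]
        abel
      obtain ⟨x, hx⟩ := exists_eq_mul_of_quotient (hne h0) hUV hYrow (hK μ hμ) hdec (hSΦ t) hT hTc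
        hMΦ (perturbed_mul_complement (P t) hinv_right hAΞc) (hBu μ hμ)
        (v := fun r _ => v r) (a := fun r _ => a r) (by
          ext r y
          exact (congrFun ha r).symm)
      refine ⟨fun r => x r (), ?_⟩
      ext r
      exact (congrFun (congrFun hx r) ()).symm
  · have h1 := isBigO_expansion_remainder Ξc hPO hZ1
    convert h1 using 2 with t
    simp only
    rw [tailFirst_mul_lead, sum_blockCol_mul, Matrix.add_mul, Matrix.mul_sub, Matrix.mul_assoc]
    abel
  · filter_upwards [hYrow, hpos] with t hr h0
    ext x y
    change (Z t - leadAll D Ξ Sg ρ) ⟨ρ, x⟩ y = _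
    simp only [Matrix.sub_apply, hZdef]
    rw [unscaled_apply_self hr, leadAll_self]
    by_cases hxy : x = y
    · subst hxy
      rw [Matrix.one_apply_eq, Matrix.diagonal_apply_eq]
      by_cases hx : (x.1 : ℕ) = 0
      · rw [if_pos hx, if_pos (eq_fst_iff.2 hx), hx]
        simp
      · rw [if_neg hx, if_neg (fun h => hx (eq_fst_iff.1 h)), ← root_pow ρ h0]
        simp
    · rw [Matrix.one_apply_ne hxy, Matrix.diagonal_apply_ne _ hxy]
      simp
  · intro i hi x y
    have h1 := isBigO_of_unscaled_of_lt hZ1 hE1 hQi hQu hZeq i hi (i.1 - 1 - x.1) x.1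
      (by have := x.1.2; omega) x.2 y
    have h2 : ∀ t, rowsOf i (Z t - leadAll D Ξ Sg ρ) x y = Z t ⟨i, x⟩ y := by
      intro t
      change (Z t - leadAll D Ξ Sg ρ) ⟨i, x⟩ y = _
      rw [Matrix.sub_apply, leadAll, dif_neg (fun h => absurd h.1 (not_le.2 hi)), sub_zero]
    refine (h1.congr_left fun t => (h2 t).symm).congr' EventuallyEq.rfl ?_
    filter_upwards [hpos] with t h0
    rw [root_pow ρ h0]
    congr 1
    have : (ρ.1 : ℝ) ≠ 0 := by have := ρ.one_le; positivity
    rw [Nat.cast_add, Nat.cast_sub hi.le]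
    field_simp
    ring
  · intro i hi x y
    -- The first block row is of order t^{1/ρ} only because the leading part is subtracted; all
    -- other block rows of the leading part are zero.
    by_cases hx : (x.1 : ℕ) = 0
    · refine (isBigO_unscaled_sub_leadAll hYO x.1 hx x.2 y).congr' EventuallyEq.rfl ?_
      filter_upwards [hpos] with t h0
      rw [hx, Nat.max_eq_right zero_le_one, Nat.min_eq_left ρ.one_le, Nat.cast_one]
      rfl
    · have h1 := isBigO_of_unscaled hZ1 hE1 hQ1 hZeq i x.1 x.1.2 x.2 y
      have h2 : ∀ t, rowsOf i (Z t - leadAll D Ξ Sg ρ) x y = Z t ⟨i, x⟩ y := by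
        intro t
        change (Z t - leadAll D Ξ Sg ρ) ⟨i, x⟩ y = _
        rw [Matrix.sub_apply, leadAll, dif_neg (fun h => hx h.2), sub_zero]
      refine (h1.congr_left fun t => (h2 t).symm).congr' EventuallyEq.rfl ?_
      filter_upwards [hpos] with t h0
      rw [root_pow ρ h0, Nat.max_eq_left (Nat.one_le_iff_ne_zero.2 hx)]
  · filter_upwards [hYrow] with t ht x y
    exact congrFun (congrFun ht x) y
  · intro p hp y
    have h1 := hYO p y
    simpa only [Matrix.sub_apply, Yzero_of_ne hp, sub_zero] using h1
  · filter_upwards [hUV, hpos] with t ht h0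
    rw [Uhat_eq_Upoly D Ξ Sg ρ (hne h0), Vhat_eq_Vpoly D Ξ Sg ρ (hne h0)]
    exact ⟨ht, fun x y => rfl, rfl⟩
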